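/- Setting. Let $\Gamma=\Gamma_A\cup\Gamma_B$ be the hexagonal lattice with sites $A_{j,k}=j(\sqrt3,0)+k(\tfrac{\sqrt3}{2},\tfrac32)$ and $B_{j,k}=A_{j,k}+(0,1)$, $j,k\in\mathbb Z$, and let $|x|$ be the graph distance of $x\in\Gamma$ to $A_{0,0}$. The shifts $S_1,S_2,S_3$ act on sites by $S_1A_{j,k}=B_{j,k-1}$, $S_2A_{j,k}=B_{j+1,k-1}$, $S_3A_{j,k}=B_{j,k}$, $S_1B_{j,k}=A_{j-1,k+1}$, $S_2B_{j,k}=A_{j,k}$, $S_3B_{j,k}=A_{j,k+1}$. For an arbitrary family $(C_x)_{x\in\Gamma}$ of unitary matrices $C_x\in U(3)$ let $U=S\mathcal C$ be the coined quantum walk on $\ell^2(\Gamma)\otimes\mathbb C^3$, where $\mathcal C(|x\rangle\otimes\tau)=|x\rangle\otimes C_x\tau$ and $S(|x\rangle\otimes e_i)=|S_ix\rangle\otimes e_i$. Let $\mathcal R$ be the set of directed edges of the lattice (each edge gives two). Let $\mathcal U=\mathcal V^{-1}U\mathcal V$ be the scattering walk on $\ell^2(\mathcal R)$, where the unitary $\mathcal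 V$ maps the directed edge $S_i^{-1}x\to x$ to $|x\rangle\otimes e_i$. Let $Q_x$ be the projection onto the span of the three edges that enter $x$. Faces and paths. Draw each directed edge as a point (its centre) slightly to the right of the lattice edge. At each site $x$ join by straight segments every incoming edge with every outgoing edge of $x$, except the reversed one. These segments divide the plane into "faces": a triangle around each site; three trapezoids around each triangle, one in each sector between two neighbouring lattice edges at the site; a parallelogram on each undirected lattice edge; a hexagon in each plaquette. Two faces are adjacent if they have a common side. A path without loops is a sequence $\gamma:\mathbb Z\to\{\text{faces}\}$ of pairwise distinct faces such that $\gamma(t)$ and $\gamma(t+1)$ are adjacent for all $t$, drawn as a curve that joins the centres of consecutive faces by crossing the common side. The set $\mathcal M\subset\mathcal R$ on the left of $\gamma$ consists of the directed edges whose centre can be joined, along sides of faces and without crossing $\gamma$, with the left end point of some side crossed by $\gamma$. A step of $\gamma$ is a part of $\gamma$ between two times $s<t$ such that $\gamma(s)$ and $\gamma(t)$ are hexagons or parallelograms and, for a single site $x$, all faces in between are the triangle at $x$, trapezoids at $x$, or parallelograms on lattice edges of $x$. It is an $hh$-step if it starts and ends in hexagons, and a $pp$-step if it starts and ends in parallelograms.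 The path $\gamma$ is relevant if it is without loops and there is $N\ge0$ such that it performs only $hh$-steps for all $t\le-N$ and only $pp$-steps for all $t\ge N$ (i.e. these two parts of $\gamma$ are covered by consecutive steps of that kind). Statement. Let $\gamma$ be a relevant path, $\mathcal M\subset\mathcal R$ the set of directed edges on the left of $\gamma$, $P$ the orthogonal projection of $\ell^2(\mathcal R)$ onto the span of $\mathcal M$, $P^\perp=1-P$, and $\Phi=\mathcal U^*P\,\mathcal U-P$. Let $\Gamma_\gamma=\{x\in\Gamma : P^\perp\mathcal U P Q_x\neq0\text{ or }P\,\mathcal U P^\perp Q_x\neq0\}$. Suppose that there exists $R>0$ such that $$\sup_{x\in\Gamma_\gamma,\ |x|>R}\|\Phi Q_x\|<1 .$$ Then $1$ is an isolated eigenvalue of finite multiplicity of $\Phi^2$, so that the index $$\operatorname{ind}(\Phi)=\dim\ker(\Phi-1)-\dim\ker(\Phi+1)$$ is well-defined, and $\operatorname{ind}(\Phi)=\pm1$, i.e. $\operatorname{ind}(\Phi)\in\{1,-1\}$. -/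

import Mathlib

namespace HexWalk

/-! ## The hexagonal lattice -/

/-- The sites of the hexagonal lattice: `A j k` is `j (√3, 0) + k (√3/2, 3/2)` and `B j k` is
`A j k + (0, 1)`; in the notation of bra-kets these are `|j,k⟩ ⊗ f₁` and `|j,k⟩ ⊗ f₂`. -/
inductive Site : Type
  | A (j k : ℤ)
  | B (j k : ℤ)

/-- The action of the shift operators on sites (the labels `1, 2, 3` are `0, 1, 2` here). -/
def shiftFun : Fin 3 → Site → Site
  | 0, .A j k => .B j (k - 1)
  | 1, .A j k => .B (j + 1) (k - 1)
  | 2, .A j k => .B j k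
  | 0, .B j k => .A (j - 1) (k + 1)
  | 1, .B j k => .A j k
  | 2, .B j k => .A j (k + 1)

/-- The inverse of the shifts on sites. -/
def shiftInv : Fin 3 → Site → Site
  | 0, .A j k => .B (j + 1) (k - 1)
  | 1, .A j k => .B j k
  | 2, .A j k => .B j (k - 1)
  | 0, .B j k => .A j (k + 1)
  | 1, .B j k => .A (j - 1) (k + 1)
  | 2, .B j k => .A j k

/-- The shift `S_i` as a bijection of the set of sites. -/
def shift (i : Fin 3) : Site ≃ Site where
  toFun := shiftFun i
  invFun := shiftInv i
  left_inv x := by fin_cases i <;> cases x <;> simp [shiftFun, shiftInv]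
  right_inv x := by fin_cases i <;> cases x <;> simp [shiftFun, shiftInv]

theorem exists_shift_symm (i : Fin 3) (x : Site) : ∃ i', shift i' (shift i x) = x := by
  fin_cases i <;> cases x
  · exact ⟨2, by simp [shift, shiftFun]⟩
  · exact ⟨1, by simp [shift, shiftFun]⟩
  · exact ⟨0, by simp [shift, shiftFun]⟩
  · exact ⟨2, by simp [shift, shiftFun]⟩
  · exact ⟨1, by simp [shift, shiftFun]⟩
  · exact ⟨0, by simp [shift, shiftFun]⟩

theorem shift_ne (i : Fin 3) (x : Site) : shift i x ≠ x := by
  fin_cases i <;> cases x <;> simp [shift, shiftFun]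

/-- The hexagonal lattice as a graph: the three neighbours of `x` are `S_1 x`, `S_2 x`, `S_3 x`. -/
def hexLattice : SimpleGraph Site where
  Adj x y := ∃ i, shift i x = y
  symm := ⟨fun x _ h => by obtain ⟨i, rfl⟩ := h; exact exists_shift_symm i x⟩
  loopless := ⟨fun x h => by obtain ⟨i, hi⟩ := h; exact shift_ne i x hi⟩

/-- `|x|`, the graph distance of `x` to the origin. -/
noncomputable def siteNorm (x : Site) : ℝ := (hexLattice.dist (.A 0 0) x : ℝ)

/-- The set `𝓡`: every edge of the lattice is split into its two directed edges. -/
abbrev DirEdge : Type := hexLattice.Dart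

/-- The directed edge from `x` to `S_i x`. -/
def outEdge (x : Site) (i : Fin 3) : DirEdge := ⟨(x, shift i x), ⟨i, rfl⟩⟩

/-- The directed edge from `S_i⁻¹ x` to `x`, on which the walker with coin state `e_i` at `x`
arrived at `x`. -/
def inEdge (p : Site × Fin 3) : DirEdge :=
  ⟨((shift p.2).symm p.1, p.1), ⟨p.2, (shift p.2).apply_symm_apply p.1⟩⟩

theorem inEdge_bijective : Function.Bijective inEdge := by
  constructor
  · rintro ⟨x, i⟩ ⟨y, j⟩ h
    have h2 : x = y := congrArg (fun d : DirEdge => d.snd) h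
    have h1 : (shift i).symm x = (shift j).symm y := congrArg (fun d : DirEdge => d.fst) h
    subst h2
    have : i = j := by
      revert h1
      fin_cases i <;> fin_cases j <;> cases x <;> simp [shift, shiftInv] <;> omega
    rw [this]
  · rintro ⟨⟨x, y⟩, i, hi⟩
    dsimp only at hi
    subst hi
    refine ⟨(shift i x, i), ?_⟩
    apply SimpleGraph.Dart.ext
    simp [inEdge]

/-! ## Operators on `ℓ²` -/

/-- The Hilbert space `ℓ²(ι)`. -/
abbrev L2 (ι : Type) : Type := lp (fun _ : ι => ℂ) 2

/-- Multiplication by a function bounded by `1`. -/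
noncomputable def diagOp {ι : Type} (a : ι → ℂ) (ha : ∀ p, ‖a p‖ ≤ 1) : L2 ι →L[ℂ] L2 ι :=
  LinearMap.mkContinuous
    { toFun := fun ψ => ⟨fun p => a p * ψ p, (lp.memℓp ψ).mono' fun p => by
        rw [norm_mul]
        exact mul_le_of_le_one_left (norm_nonneg _) (ha p)⟩
      map_add' := fun ψ φ => by
        apply lp.ext; funext p; exact mul_add _ _ _
      map_smul' := fun c ψ => by
        apply lp.ext; funext p; exact mul_left_comm _ _ _ }
    1
    (fun ψ => by
      rw [one_mul]
      refine lp.norm_mono (by norm_num) fun p => ?_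
      change ‖a p * ψ p‖ ≤ _
      rw [norm_mul]
      exact mul_le_of_le_one_left (norm_nonneg _) (ha p))

/-- The unitary `ℓ²(ι) → ℓ²(κ)` that maps the basis vector `|p⟩` to `|e p⟩`. -/
noncomputable def reindex {ι κ : Type} (e : ι ≃ κ) : L2 ι ≃ₗᵢ[ℂ] L2 κ where
  toFun ψ := ⟨fun q => ψ (e.symm q), memℓp_gen
    (((lp.memℓp ψ).summable (by norm_num)).comp_injective e.symm.injective)⟩
  invFun φ := ⟨fun p => φ (e p), memℓp_gen
    (((lp.memℓp φ).summable (by norm_num)).comp_injective e.injective)⟩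
  left_inv ψ := by
    apply lp.ext; funext p; exact congrArg (fun q => ψ q) (e.symm_apply_apply p)
  right_inv φ := by
    apply lp.ext; funext p; exact congrArg (fun q => φ q) (e.apply_symm_apply p)
  map_add' _ _ := rfl
  map_smul' _ _ := rfl
  norm_map' ψ := by
    rw [lp.norm_eq_tsum_rpow (by norm_num), lp.norm_eq_tsum_rpow (by norm_num)]
    congr 1
    exact e.symm.tsum_eq (fun p => ‖ψ p‖ ^ (2 : ENNReal).toReal)

open Classical in
/-- The orthogonal projection `∑_{p ∈ s} |p⟩⟨p|` of `ℓ²(ι)`. -/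
noncomputable def proj {ι : Type} (s : Set ι) : L2 ι →L[ℂ] L2 ι :=
  diagOp (fun p => if p ∈ s then 1 else 0) (fun p => by split_ifs <;> simp)

/-! ## The walk -/

/-- The coin operator of a family of unitary coin matrices on `ℓ²(Γ) ⊗ ℂ³ = ℓ²(Γ × {1,2,3})`,
written as the sum of its three cyclic diagonals; see `coinOp_apply`. -/
noncomputable def coinOp (C : Site → Matrix.unitaryGroup (Fin 3) ℂ) :
    L2 (Site × Fin 3) →L[ℂ] L2 (Site × Fin 3) :=
  ∑ m : Fin 3,
    (diagOp (fun p : Site × Fin 3 => (C p.1 : Matrix (Fin 3) (Fin 3) ℂ) p.2 (p.2 + m))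
      (fun p => entry_norm_bound_of_unitary (C p.1).2 _ _)) ∘L
    ((reindex ((Equiv.refl Site).prodCongr (Equiv.addRight m).symm)).toContinuousLinearEquiv :
      L2 (Site × Fin 3) →L[ℂ] L2 (Site × Fin 3))

theorem coinOp_apply (C : Site → Matrix.unitaryGroup (Fin 3) ℂ) (ψ : L2 (Site × Fin 3))
    (x : Site) (i : Fin 3) :
    coinOp C ψ (x, i) = ∑ j, (C x : Matrix (Fin 3) (Fin 3) ℂ) i j * ψ (x, j) := by
  have h : coinOp C ψ (x, i)
      = ∑ m : Fin 3, (C x : Matrix (Fin 3) (Fin 3) ℂ) i (i + m) * ψ (x, i + m) := by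
    simp only [coinOp, sum_apply, lp.coeFn_sum, Finset.sum_apply]
    rfl
  rw [h]
  exact Equiv.sum_comp (Equiv.addLeft i)
    (fun j => (C x : Matrix (Fin 3) (Fin 3) ℂ) i j * ψ (x, j))

/-- The shift operator `∑_i S_i ⊗ |e_i⟩⟨e_i|`. -/
noncomputable def shiftOp : L2 (Site × Fin 3) ≃ₗᵢ[ℂ] L2 (Site × Fin 3) :=
  reindex
    { toFun := fun p => (shift p.2 p.1, p.2)
      invFun := fun p => ((shift p.2).symm p.1, p.2)
      left_inv := fun p => by simp
      right_inv := fun p => by simp }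

/-- The coined quantum walk `U = S 𝓒`. -/
noncomputable def coinedWalk (C : Site → Matrix.unitaryGroup (Fin 3) ℂ) :
    L2 (Site × Fin 3) →L[ℂ] L2 (Site × Fin 3) :=
  (shiftOp.toContinuousLinearEquiv : L2 (Site × Fin 3) →L[ℂ] L2 (Site × Fin 3)) ∘L coinOp C

/-- The unitary `𝓥 : ℓ²(𝓡) → ℓ²(Γ) ⊗ ℂ³` identifying the incoming edges of a site with the
basis of its coin space. -/
noncomputable def edgeToCoin : L2 DirEdge ≃ₗᵢ[ℂ] L2 (Site × Fin 3) :=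
  reindex (Equiv.ofBijective inEdge inEdge_bijective).symm

/-- The scattering quantum walk `𝓤 = 𝓥⁻¹ U 𝓥` on `ℓ²(𝓡)`. -/
noncomputable def scatteringWalk (C : Site → Matrix.unitaryGroup (Fin 3) ℂ) :
    L2 DirEdge →L[ℂ] L2 DirEdge :=
  (edgeToCoin.symm.toContinuousLinearEquiv : L2 (Site × Fin 3) →L[ℂ] L2 DirEdge) ∘L
    coinedWalk C ∘L
    (edgeToCoin.toContinuousLinearEquiv : L2 DirEdge →L[ℂ] L2 (Site × Fin 3))

/-- `Q_x`, the projection onto the span of the incoming edges of `x`. -/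
noncomputable def inProj (x : Site) : L2 DirEdge →L[ℂ] L2 DirEdge := proj {d | d.snd = x}

/-- The flux operator `Φ = 𝓤* P 𝓤 - P`, where `P` is the projection onto `M ⊆ 𝓡`. -/
noncomputable def flux (C : Site → Matrix.unitaryGroup (Fin 3) ℂ) (M : Set DirEdge) :
    L2 DirEdge →L[ℂ] L2 DirEdge :=
  ContinuousLinearMap.adjoint (scatteringWalk C) ∘L proj M ∘L scatteringWalk C - proj M

/-- `Γ_γ`, the set of sites at which the walk passes from `M` to its complement or back. -/
def boundarySites (C : Site → Matrix.unitaryGroup (Fin 3) ℂ) (M : Set DirEdge) : Set Site :=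
  {x | (1 - proj M) ∘L scatteringWalk C ∘L proj M ∘L inProj x ≠ 0 ∨
    proj M ∘L scatteringWalk C ∘L (1 - proj M) ∘L inProj x ≠ 0}

/-! ## The index -/

/-- The index of `Φ` is well-defined: `1` is an isolated eigenvalue of finite multiplicity
of `Φ²`. -/
def IndexDefined {H : Type} [NormedAddCommGroup H] [InnerProductSpace ℂ H]
    (Φ : H →L[ℂ] H) : Prop :=
  Module.End.HasEigenvalue ((Φ ^ 2 : H →L[ℂ] H) : H →ₗ[ℂ] H) 1 ∧
  FiniteDimensional ℂ (Module.End.eigenspace ((Φ ^ 2 : H →L[ℂ] H) : H →ₗ[ℂ] H) 1) ∧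
  ∃ ε : ℝ, 0 < ε ∧ ∀ z ∈ spectrum ℂ (Φ ^ 2), z ≠ 1 → ε ≤ ‖z - 1‖

/-- `ind(Φ) = dim ker (Φ - 1) - dim ker (Φ + 1)`. -/
noncomputable def fluxIndex {H : Type} [NormedAddCommGroup H] [InnerProductSpace ℂ H]
    (Φ : H →L[ℂ] H) : ℤ :=
  (Module.finrank ℂ (Module.End.eigenspace (Φ : H →ₗ[ℂ] H) 1) : ℤ) -
    (Module.finrank ℂ (Module.End.eigenspace (Φ : H →ₗ[ℂ] H) (-1)) : ℤ)

/-! ## The faces of the scattering graph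

Seen from a site `x`, the three neighbours `S_i x`, `i = 0, 1, 2`, follow each other
counterclockwise (indices modulo 3). The `i`-th corner at `x` is the sector between the directions
of `S_i x` and `S_{i+1} x`. Of the two directed edges between `x` and `S_i x`, both drawn next to
the edge of the lattice, each has its centre to the right of that edge, seen in its own direction.
So around `x` the six edge centres are, counterclockwise,
`out 0, in 0, out 1, in 1, out 2, in 2`, where `out i` is the edge `x → S_i x` and `in i` the
reversed edge `S_i x → x`. The links at `x`, without those that join `in i` and `out i`, are drawn
as the six straight segments `in i – out (i+1)` and `out i – in (i+1)`. The three segments of the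
second kind cross pairwise, `out i – in (i+1)` and `out (i-1) – in i` in a point that we call
`cross x i`. They cut out a triangle around `x`, and three trapezoids between this triangle and the
segments of the first kind. The two drawings at the ends of a lattice edge leave a parallelogram
between them, with corners `cross x i`, `in i`, `out i` and the crossing point at the other end.
What remains of a plaquette of the lattice is a hexagon. -/

/-- The plaquette which contains the `i`-th corner at `x`. The plaquette `(j, k)` is the one with
centre `A j k - (0, 1)`. -/
def plaquette : Site → Fin 3 → ℤ × ℤ
  | .A j k, 0 => (j, k)
  | .A j k, 1 => (j, k + 1)
  | .A j k, 2 => (j - 1, k + 1)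
  | .B j k, 0 => (j - 1, k + 1)
  | .B j k, 1 => (j, k + 1)
  | .B j k, 2 => (j - 1, k + 2)

/-- The faces of the scattering graph, which stand for their centres `𝓡*`: a hexagon in each
plaquette, a parallelogram on each edge of the lattice, a trapezoid in each corner at each site and
a triangle around each site. -/
inductive Face : Type
  | hexagon (p : ℤ × ℤ)
  | parallelogram (e : hexLattice.edgeSet)
  | trapezoid (x : Site) (i : Fin 3)
  | triangle (x : Site)

/-- The parallelogram between `x` and `S_i x`. -/
def Face.para (x : Site) (i : Fin 3) : Face :=
  .parallelogram ⟨(outEdge x i).edge, (outEdge x i).edge_mem⟩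

/-- The points at which the sides of the faces end: the centres of the directed edges, and the
points where two links cross. -/
inductive Vertex : Type
  | edge (d : DirEdge)
  | cross (x : Site) (i : Fin 3)

/-- `Crosses F F' l r`: the faces `F` and `F'` have a common side, and whoever crosses it from `F`
to `F'` has its end point `l` on the left and its end point `r` on the right. -/
inductive Crosses : Face → Face → Vertex → Vertex → Prop
  | trapezoid_hexagon (x : Site) (i : Fin 3) :
      Crosses (.trapezoid x i) (.hexagon (plaquette x i))
        (.edge (outEdge x (i + 1))) (.edge (outEdge x i).symm)
  | trapezoid_para (x : Site) (i : Fin 3) :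
      Crosses (.trapezoid x i) (.para x i) (.edge (outEdge x i).symm) (.cross x i)
  | trapezoid_para_succ (x : Site) (i : Fin 3) :
      Crosses (.trapezoid x i) (.para x (i + 1)) (.cross x (i + 1)) (.edge (outEdge x (i + 1)))
  | trapezoid_triangle (x : Site) (i : Fin 3) :
      Crosses (.trapezoid x i) (.triangle x) (.cross x i) (.cross x (i + 1))
  | reverse {F F' : Face} {l r : Vertex} : Crosses F F' l r → Crosses F' F r l

/-! ## Paths -/

/-- A path through centres of adjacent faces without loops. -/
structure IsPath (γ : ℤ → Face) : Prop where
  adjacent : ∀ t, ∃ l r, Crosses (γ t) (γ (t + 1)) l r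
  injective : Function.Injective γ

/-- `p` and `q` are the end points of a side of a face which `γ` does not cross. -/
def JoinedOff (γ : ℤ → Face) (p q : Vertex) : Prop :=
  ∃ F F', Crosses F F' p q ∧
    ∀ t, ¬(γ t = F ∧ γ (t + 1) = F') ∧ ¬(γ t = F' ∧ γ (t + 1) = F)

/-- The set of directed edges to the left of `γ`: those whose centre can be joined, along sides of
faces and without crossing `γ`, with a point immediately to the left of `γ`. -/
def leftSide (γ : ℤ → Face) : Set DirEdge :=
  {d | ∃ t l r, Crosses (γ t) (γ (t + 1)) l r ∧
    Relation.ReflTransGen (JoinedOff γ) l (.edge d)}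

/-- The face is a hexagon. -/
def Face.IsHexagon (F : Face) : Prop := ∃ p, F = .hexagon p

/-- The face is a parallelogram. -/
def Face.IsParallelogram (F : Face) : Prop := ∃ e, F = .parallelogram e

/-- The faces through which a path can pass the site `x`: the triangle and the trapezoids at `x`,
and the parallelograms on the edges of `x`. -/
def Face.IsAt (x : Site) : Face → Prop
  | .hexagon _ => False
  | .parallelogram e => x ∈ (e : Sym2 Site)
  | .trapezoid y _ => y = x
  | .triangle y => y = x

/-- Between the times `s` and `t` the path passes a single site. -/
def IsStep (γ : ℤ → Face) (s t : ℤ) : Prop :=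
  s < t ∧ ∃ x : Site, ∀ r, s < r → r < t → (γ r).IsAt x

/-- Between the times `s` and `t` the path performs an `hh`-step. -/
def IsHHStep (γ : ℤ → Face) (s t : ℤ) : Prop :=
  IsStep γ s t ∧ (γ s).IsHexagon ∧ (γ t).IsHexagon

/-- Between the times `s` and `t` the path performs a `pp`-step. -/
def IsPPStep (γ : ℤ → Face) (s t : ℤ) : Prop :=
  IsStep γ s t ∧ (γ s).IsParallelogram ∧ (γ t).IsParallelogram

/-- A path without loops is relevant if for some `N ≥ 0` it performs only `hh`-steps for all
`t ≤ -N` and only `pp`-steps for all `t ≥ N`, that is, these parts of the path are covered by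
consecutive `hh`-steps, respectively `pp`-steps. -/
structure IsRelevant (γ : ℤ → Face) : Prop extends IsPath γ where
  tails : ∃ N : ℕ,
    (∃ a : ℕ → ℤ, StrictAnti a ∧ -(N : ℤ) ≤ a 0 ∧ ∀ n, IsHHStep γ (a (n + 1)) (a n)) ∧
    (∃ b : ℕ → ℤ, StrictMono b ∧ b 0 ≤ (N : ℤ) ∧ ∀ n, IsPPStep γ (b n) (b (n + 1)))

end HexWalk

open HexWalk

/-! The walk maps the edges that enter a site `x` to those that leave `x`, so `Φ` commutes with
every `Q_x` and is block diagonal, with blocks of size 3. By hypothesis the blocks outside a finite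
set `S` of sites have norm at most some `c < 1` (they vanish outside `Γ_γ`). The spectrum of `Φ²`
near `1` and the eigenvectors for `±1` therefore come from the part of `Φ` on `S`. That part is a
difference of two projections of finite rank, one onto the walk's preimage of the edges of `M`
leaving `S`, the other onto the edges of `M` entering `S`. The index of such a difference is the
difference of the ranks (`fluxIndex_sub`), here the sum over `S` of `outMinusIn`. Once this is
nonzero, `1` is an eigenvalue of `Φ²` (`indexDefined_flux`).

The count needs a discrete Jordan curve theorem: the left and the right of `γ` are not joined. A
path without loops enters and leaves each visited face once, so its net flow through the sides of
any face is zero. Since the lattice has no holes, the flow is the difference of a potential on the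
vertices (`IsPath.exists_potential`). This potential takes one value `c` on the left and `c - 1` on
the right (`IsPath.exists_levels`), so the indicator function of `M` jumps by the flow across each
side.

Around a site, outgoing minus incoming edges of `M` regroup into jumps across the sides between
trapezoids and hexagons: the count at `x` is the net flow of `γ` from `x` into hexagons. An
`hh`-step or a `pp`-step contributes nothing at any site. What remains is a finite stretch of `γ`
from a hexagon to a parallelogram; summed over the sites, its flow telescopes to `0 - 1 = -1`
(`IsRelevant.exists_sum_outMinusIn`). -/

namespace HexWalk

/-! ## Labels of reversed edges -/

/-- The label of the shift that leads from `S_i x` back to `x`. -/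
def backLabel : Site → Fin 3 → Fin 3
  | .A _ _, i => i + 2
  | .B _ _, i => i + 1

theorem shift_backLabel (x : Site) (i : Fin 3) : shift (backLabel x i) (shift i x) = x := by
  cases x <;> fin_cases i <;> simp [shift, shiftFun, backLabel]

theorem backLabel_shift (x : Site) (i : Fin 3) : backLabel (shift i x) (backLabel x i) = i := by
  cases x <;> fin_cases i <;> simp [shift, shiftFun, backLabel]

theorem shift_label_injective (x : Site) {i j : Fin 3} (h : shift i x = shift j x) : i = j := by
  revert h
  cases x <;> fin_cases i <;> fin_cases j <;> simp [shift, shiftFun] <;> omega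

theorem outEdge_backLabel (x : Site) (i : Fin 3) :
    outEdge (shift i x) (backLabel x i) = (outEdge x i).symm := by
  apply SimpleGraph.Dart.ext
  simp [outEdge, shift_backLabel]

theorem para_backLabel (x : Site) (i : Fin 3) :
    Face.para (shift i x) (backLabel x i) = Face.para x i := by
  simp [Face.para, outEdge_backLabel]

theorem para_eq_iff {x y : Site} {i j : Fin 3} :
    Face.para x i = Face.para y j ↔
      (x = y ∧ i = j) ∨ (x = shift j y ∧ i = backLabel y j) := by
  constructor
  · intro h
    have h' : s(x, shift i x) = s(y, shift j y) :=
      congrArg Subtype.val (Face.parallelogram.inj h)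
    rcases Sym2.eq_iff.1 h' with ⟨rfl, h⟩ | ⟨rfl, h⟩
    · exact .inl ⟨rfl, shift_label_injective _ h⟩
    · refine .inr ⟨rfl, shift_label_injective (shift j y) ?_⟩
      rw [h, shift_backLabel]
  · rintro (⟨rfl, rfl⟩ | ⟨rfl, rfl⟩)
    · rfl
    · exact para_backLabel _ _

/-- Every property of sites that is inherited by the neighbours holds everywhere. -/
theorem site_induction {p : Site → Prop} {x₀ : Site} (h₀ : p x₀)
    (hs : ∀ x i, p x → p (shift i x)) : ∀ x, p x := by
  have hs' : ∀ x i, p (shift i x) → p x := fun x i h => by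
    have := hs _ (backLabel x i) h
    rwa [shift_backLabel] at this
  have hAB : ∀ j k, p (.A j k) ↔ p (.B j k) := fun j k => ⟨hs (.A j k) 2, hs' (.A j k) 2⟩
  have hk : ∀ j k, p (.B j k) ↔ p (.A j (k + 1)) := fun j k => ⟨hs (.B j k) 2, hs' (.B j k) 2⟩
  have hj : ∀ j k, p (.A j (k + 1)) ↔ p (.B (j + 1) k) := fun j k => by
    have h1 := hs (.A j (k + 1)) 1
    have h2 := hs' (.A j (k + 1)) 1
    simp only [shift, shiftFun, Equiv.coe_fn_mk, add_sub_cancel_right] at h1 h2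
    exact ⟨h1, h2⟩
  -- Two lattice edges in succession translate the sublattice of `A` sites by a basis vector.
  have hk' : ∀ j k, p (.A j (k + 1)) ↔ p (.A j k) := fun j k => by rw [← hk, hAB]
  have hj' : ∀ j k, p (.A (j + 1) k) ↔ p (.A j k) := fun j k => by rw [hAB, ← hj, hk']
  have hk0 : ∀ j k, p (.A j k) ↔ p (.A j 0) := fun j k => by
    induction k with
    | zero => rfl
    | succ n ih => rw [hk', ih]
    | pred n ih => rw [← ih, ← hk' j (-n - 1), sub_add_cancel]
  have hj0 : ∀ j, p (.A j 0) ↔ p (.A 0 0) := fun j => by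
    induction j with
    | zero => rfl
    | succ n ih => rw [hj', ih]
    | pred n ih => rw [← ih, ← hj' (-n - 1), sub_add_cancel]
  have h00 : p (.A 0 0) := by
    cases x₀ with
    | A j k => exact (hj0 j).1 ((hk0 j k).1 h₀)
    | B j k => exact (hj0 j).1 ((hk0 j k).1 ((hAB j k).2 h₀))
  intro x
  cases x with
  | A j k => exact (hk0 j k).2 ((hj0 j).2 h00)
  | B j k => exact (hAB j k).1 ((hk0 j k).2 ((hj0 j).2 h00))

/-! ## Boundaries of faces -/

/-- The sides of `F` are, counterclockwise, those from `ν j` to `ν (j + 1)` for `j < n`, and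
behind the `j`-th side lies the face `σ j`. -/
structure IsBoundary (F : Face) (n : ℕ) (ν : ℕ → Vertex) (σ : ℕ → Face) : Prop where
  closed : ν n = ν 0
  crosses : ∀ j < n, Crosses F (σ j) (ν (j + 1)) (ν j)
  exhaust : ∀ {F' l r}, Crosses F F' l r → ∃ j < n, σ j = F' ∧ ν (j + 1) = l ∧ ν j = r
  injOn : ∀ i < n, ∀ j < n, σ i = σ j → i = j

/-- The pairs of adjacent faces, the first of which is a trapezoid. -/
inductive CrossesFrom : Face → Face → Vertex → Vertex → Prop
  | hexagon (x : Site) (i : Fin 3) :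
      CrossesFrom (.trapezoid x i) (.hexagon (plaquette x i))
        (.edge (outEdge x (i + 1))) (.edge (outEdge x i).symm)
  | para (x : Site) (i : Fin 3) :
      CrossesFrom (.trapezoid x i) (.para x i) (.edge (outEdge x i).symm) (.cross x i)
  | para_succ (x : Site) (i : Fin 3) :
      CrossesFrom (.trapezoid x i) (.para x (i + 1)) (.cross x (i + 1)) (.edge (outEdge x (i + 1)))
  | triangle (x : Site) (i : Fin 3) :
      CrossesFrom (.trapezoid x i) (.triangle x) (.cross x i) (.cross x (i + 1))

/-- Every generating side starts in a trapezoid, so iterated reversals reduce to a choice between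
two orientations. -/
theorem crosses_iff {F F' : Face} {l r : Vertex} :
    Crosses F F' l r ↔ CrossesFrom F F' l r ∨ CrossesFrom F' F r l := by
  constructor
  · intro h
    induction h with
    | trapezoid_hexagon x i => exact .inl (.hexagon x i)
    | trapezoid_para x i => exact .inl (.para x i)
    | trapezoid_para_succ x i => exact .inl (.para_succ x i)
    | trapezoid_triangle x i => exact .inl (.triangle x i)
    | reverse _ ih => exact ih.symm
  · rintro (h | h)
    · cases h
      · exact .trapezoid_hexagon _ _
      · exact .trapezoid_para _ _
      · exact .trapezoid_para_succ _ _
      · exact .trapezoid_triangle _ _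
    · cases h
      · exact .reverse (.trapezoid_hexagon _ _)
      · exact .reverse (.trapezoid_para _ _)
      · exact .reverse (.trapezoid_para_succ _ _)
      · exact .reverse (.trapezoid_triangle _ _)

/-- Stated with equations, because the indices `plaquette x i` and `Face.para x i` are not
constructor patterns and obstruct a case split once the faces are given. -/
theorem crossesFrom_iff {F F' : Face} {l r : Vertex} :
    CrossesFrom F F' l r ↔ ∃ x i, F = .trapezoid x i ∧
      ((F' = .hexagon (plaquette x i) ∧ l = .edge (outEdge x (i + 1)) ∧
          r = .edge (outEdge x i).symm) ∨
        (F' = .para x i ∧ l = .edge (outEdge x i).symm ∧ r = .cross x i) ∨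
        (F' = .para x (i + 1) ∧ l = .cross x (i + 1) ∧ r = .edge (outEdge x (i + 1))) ∨
        (F' = .triangle x ∧ l = .cross x i ∧ r = .cross x (i + 1))) := by
  constructor
  · intro h
    cases h <;> exact ⟨_, _, rfl, by simp⟩
  · rintro ⟨x, i, rfl, (⟨rfl, rfl, rfl⟩ | ⟨rfl, rfl, rfl⟩ | ⟨rfl, rfl, rfl⟩ | ⟨rfl, rfl, rfl⟩)⟩
    · exact .hexagon _ _
    · exact .para _ _
    · exact .para_succ _ _
    · exact .triangle _ _

theorem isBoundary_triangle (x : Site) :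
    IsBoundary (.triangle x) 3
      (fun | 0 => .cross x 0 | 1 => .cross x 1 | 2 => .cross x 2 | _ => .cross x 0)
      (fun | 0 => .trapezoid x 0 | 1 => .trapezoid x 1 | _ => .trapezoid x 2) where
  closed := rfl
  crosses j hj := by
    interval_cases j <;> exact .reverse (.trapezoid_triangle x _)
  exhaust {F' l r} h := by
    rw [crosses_iff, crossesFrom_iff, crossesFrom_iff] at h
    simp only [reduceCtorEq, false_and, exists_false, false_or] at h
    obtain ⟨y, i, rfl, h⟩ := h
    simp only [Face.para, reduceCtorEq, false_and, false_or, Face.triangle.injEq] at h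
    obtain ⟨rfl, rfl, rfl⟩ := h
    fin_cases i
    · exact ⟨0, by simp⟩
    · exact ⟨1, by simp⟩
    · exact ⟨2, by simp⟩
  injOn i hi j hj h := by
    interval_cases i <;> interval_cases j <;> simp_all

theorem isBoundary_trapezoid (x : Site) (i : Fin 3) :
    IsBoundary (.trapezoid x i) 4
      (fun | 0 => .cross x i | 1 => .edge (outEdge x i).symm | 2 => .edge (outEdge x (i + 1))
           | 3 => .cross x (i + 1) | _ => .cross x i)
      (fun | 0 => .para x i | 1 => .hexagon (plaquette x i) | 2 => .para x (i + 1)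
           | _ => .triangle x) where
  closed := rfl
  crosses j hj := by
    interval_cases j
    · exact .trapezoid_para x i
    · exact .trapezoid_hexagon x i
    · exact .trapezoid_para_succ x i
    · exact .trapezoid_triangle x i
  exhaust {F' l r} h := by
    rw [crosses_iff, crossesFrom_iff, crossesFrom_iff] at h
    simp only [Face.para, reduceCtorEq, false_and, or_false, and_false,
      exists_false, Face.trapezoid.injEq] at h
    obtain ⟨y, i', ⟨rfl, rfl⟩, h⟩ := h
    rcases h with ⟨rfl, rfl, rfl⟩ | ⟨rfl, rfl, rfl⟩ | ⟨rfl, rfl, rfl⟩ | ⟨rfl, rfl, rfl⟩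
    · exact ⟨1, by simp⟩
    · exact ⟨0, by simp [Face.para]⟩
    · exact ⟨2, by simp [Face.para]⟩
    · exact ⟨3, by simp⟩
  injOn a ha b hb h := by
    -- The only two faces of the same kind around a trapezoid.
    have hne : Face.para x i ≠ Face.para x (i + 1) := by
      rw [Ne, para_eq_iff]
      rintro (⟨-, h⟩ | ⟨h, -⟩)
      · revert h; fin_cases i <;> simp
      · exact shift_ne _ _ h.symm
    have hne' := hne.symm
    interval_cases a <;> interval_cases b <;> first | rfl | exact absurd h hne | exact absurd h hne' | exact absurd h nofun

theorem isBoundary_para (x : Site) (i : Fin 3) :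
    IsBoundary (.para x i) 4
      (fun | 0 => .edge (outEdge x i).symm | 1 => .cross x i | 2 => .edge (outEdge x i)
           | 3 => .cross (shift i x) (backLabel x i) | _ => .edge (outEdge x i).symm)
      (fun | 0 => .trapezoid x i | 1 => .trapezoid x (i + 2)
           | 2 => .trapezoid (shift i x) (backLabel x i)
           | _ => .trapezoid (shift i x) (backLabel x i + 2)) where
  closed := rfl
  crosses j hj := by
    -- Modulo 3, `i + 2` is the corner before `i`; the two corners along the lattice edge at `x` are
    -- `i + 2` and `i`, and likewise at its other end.
    have h3 : ∀ i : Fin 3, i + 2 + 1 = i := by decide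
    have hs : (outEdge (shift i x) (backLabel x i)).symm = outEdge x i := by
      rw [outEdge_backLabel, SimpleGraph.Dart.symm_symm]
    interval_cases j
    · exact .reverse (.trapezoid_para x i)
    · have := Crosses.reverse (.trapezoid_para_succ x (i + 2))
      rwa [h3] at this
    · have := Crosses.reverse (.trapezoid_para (shift i x) (backLabel x i))
      rwa [para_backLabel, hs] at this
    · have := Crosses.reverse (.trapezoid_para_succ (shift i x) (backLabel x i + 2))
      rwa [h3, para_backLabel, outEdge_backLabel] at this
  exhaust {F' l r} h := by
    have h3 : ∀ i i' : Fin 3, i' + 1 = i → i' = i + 2 := by decide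
    have hs : (outEdge (shift i x) (backLabel x i)).symm = outEdge x i := by
      rw [outEdge_backLabel, SimpleGraph.Dart.symm_symm]
    rw [crosses_iff, crossesFrom_iff, crossesFrom_iff] at h
    rcases h with ⟨y, i', h, -⟩ | ⟨y, i', rfl, h⟩
    · exact absurd h nofun
    rcases h with ⟨h, -⟩ | ⟨h, rfl, rfl⟩ | ⟨h, rfl, rfl⟩ | ⟨h, -⟩
    · exact absurd h nofun
    · rcases para_eq_iff.1 h.symm with ⟨rfl, rfl⟩ | ⟨rfl, rfl⟩
      · exact ⟨0, by simp⟩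
      · exact ⟨2, by simp [hs]⟩
    · rcases para_eq_iff.1 h.symm with ⟨rfl, hi⟩ | ⟨rfl, hi⟩
      · rw [hi]; obtain rfl := h3 _ _ hi
        exact ⟨1, by simp⟩
      · rw [hi]; obtain rfl := h3 _ _ hi
        exact ⟨3, by simp [outEdge_backLabel]⟩
    · exact absurd h nofun
  injOn a ha b hb h := by
    have h1 : ∀ i : Fin 3, i ≠ i + 2 := by decide
    have h2 := shift_ne i x
    interval_cases a <;> interval_cases b <;>
      simp_all [h2.symm, (h1 i).symm, (h1 (backLabel x i)).symm]

theorem plaquette_eq_iff {x : Site} {i : Fin 3} {j k : ℤ} :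
    plaquette x i = (j, k) ↔ (x = .A j k ∧ i = 0) ∨ (x = .B j (k - 1) ∧ i = 1) ∨
      (x = .A j (k - 1) ∧ i = 1) ∨ (x = .B (j + 1) (k - 2) ∧ i = 2) ∨
      (x = .A (j + 1) (k - 1) ∧ i = 2) ∨ (x = .B (j + 1) (k - 1) ∧ i = 0) := by
  cases x <;> fin_cases i <;> simp [plaquette] <;> omega

theorem isBoundary_hexagon (j k : ℤ) :
    IsBoundary (.hexagon (j, k)) 6
      (fun | 0 => .edge (outEdge (.A j k) 1) | 1 => .edge (outEdge (.B j (k - 1)) 2)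
           | 2 => .edge (outEdge (.A j (k - 1)) 2) | 3 => .edge (outEdge (.B (j + 1) (k - 2)) 0)
           | 4 => .edge (outEdge (.A (j + 1) (k - 1)) 0)
           | 5 => .edge (outEdge (.B (j + 1) (k - 1)) 1) | _ => .edge (outEdge (.A j k) 1))
      (fun | 0 => .trapezoid (.A j k) 0 | 1 => .trapezoid (.B j (k - 1)) 1
           | 2 => .trapezoid (.A j (k - 1)) 1 | 3 => .trapezoid (.B (j + 1) (k - 2)) 2
           | 4 => .trapezoid (.A (j + 1) (k - 1)) 2
           | _ => .trapezoid (.B (j + 1) (k - 1)) 0) := by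
  have key : ∀ (x y : Site) (i i' : Fin 3), y = shift i x → i' = backLabel x i →
      plaquette x i = (j, k) → Crosses (.hexagon (j, k)) (.trapezoid x i)
        (.edge (outEdge y i')) (.edge (outEdge x (i + 1))) := by
    rintro x _ i _ rfl rfl h
    rw [outEdge_backLabel, ← h]
    exact .reverse (.trapezoid_hexagon x i)
  have hs : ∀ (x y : Site) (i i' : Fin 3), y = shift i x → i' = backLabel x i →
      (outEdge x i).symm = outEdge y i' := by
    rintro x _ i _ rfl rfl
    rw [outEdge_backLabel]
  -- The six sites of the plaquette in counterclockwise order: the edge that enters one site from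
  -- the next is an outgoing edge of the latter.
  have e0 := hs (.A j k) (.B j (k - 1)) 0 2 rfl rfl
  have e1 := hs (.B j (k - 1)) (.A j (k - 1)) 1 2 rfl rfl
  have e2 := hs (.A j (k - 1)) (.B (j + 1) (k - 2)) 1 0
    (by simp only [shift, shiftFun, Equiv.coe_fn_mk]; congr 1; ring) rfl
  have e3 := hs (.B (j + 1) (k - 2)) (.A (j + 1) (k - 1)) 2 0
    (by simp only [shift, shiftFun, Equiv.coe_fn_mk]; congr 1; ring) rfl
  have e4 := hs (.A (j + 1) (k - 1)) (.B (j + 1) (k - 1)) 2 1 rfl rfl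
  have e5 := hs (.B (j + 1) (k - 1)) (.A j k) 0 1
    (by simp [shift, shiftFun]) rfl
  refine ⟨rfl, ?_, ?_, ?_⟩
  · intro m hm
    interval_cases m
    · exact key _ _ 0 2 rfl rfl (plaquette_eq_iff.2 (by simp))
    · exact key _ _ 1 2 rfl rfl (plaquette_eq_iff.2 (by simp))
    · exact key (.A j (k - 1)) _ 1 0
        (by simp only [shift, shiftFun, Equiv.coe_fn_mk]; congr 1; ring) rfl
        (plaquette_eq_iff.2 (by simp))
    · exact key (.B (j + 1) (k - 2)) _ 2 0
        (by simp only [shift, shiftFun, Equiv.coe_fn_mk]; congr 1; ring) rfl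
        (plaquette_eq_iff.2 (by simp))
    · exact key _ _ 2 1 rfl rfl (plaquette_eq_iff.2 (by simp))
    · exact key (.B (j + 1) (k - 1)) _ 0 1 (by simp [shift, shiftFun]) rfl
        (plaquette_eq_iff.2 (by simp))
  · intro F' l r h
    rw [crosses_iff, crossesFrom_iff, crossesFrom_iff] at h
    simp only [Face.para, reduceCtorEq, false_and, false_or, or_false,
      exists_false, Face.hexagon.injEq] at h
    obtain ⟨x, i, rfl, h, rfl, rfl⟩ := h
    rcases plaquette_eq_iff.1 h.symm with ⟨rfl, rfl⟩ | ⟨rfl, rfl⟩ | ⟨rfl, rfl⟩ | ⟨rfl, rfl⟩ |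
      ⟨rfl, rfl⟩ | ⟨rfl, rfl⟩
    · exact ⟨0, by simp [e0]⟩
    · exact ⟨1, by simp [e1]⟩
    · exact ⟨2, by simp [e2]⟩
    · exact ⟨3, by simp [e3]⟩
    · exact ⟨4, by simp [e4]⟩
    · exact ⟨5, by simp [e5]⟩
  · intro a ha b hb h
    interval_cases a <;> interval_cases b <;> simp_all

theorem exists_isBoundary (F : Face) : ∃ n ν σ, IsBoundary F n ν σ := by
  cases F with
  | hexagon p => exact ⟨_, _, _, isBoundary_hexagon p.1 p.2⟩
  | trapezoid x i => exact ⟨_, _, _, isBoundary_trapezoid x i⟩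
  | triangle x => exact ⟨_, _, _, isBoundary_triangle x⟩
  | parallelogram e =>
    obtain ⟨e, he⟩ := e
    induction e with
    | _ x y =>
      obtain ⟨i, rfl⟩ := (SimpleGraph.mem_edgeSet _).1 he
      exact ⟨_, _, _, isBoundary_para x i⟩

theorem IsBoundary.unique {F : Face} {n : ℕ} {ν : ℕ → Vertex} {σ : ℕ → Face}
    (hb : IsBoundary F n ν σ) {j : ℕ} (hj : j < n) {l r : Vertex} (h : Crosses F (σ j) l r) :
    l = ν (j + 1) ∧ r = ν j := by
  obtain ⟨i, hi, hσ, rfl, rfl⟩ := hb.exhaust h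
  obtain rfl := hb.injOn i hi j hj hσ
  exact ⟨rfl, rfl⟩

/-- Different sides of a face have different faces behind them, so a pair of adjacent faces
determines its common side. -/
theorem Crosses.unique {F F' : Face} {l r l' r' : Vertex} (h : Crosses F F' l r)
    (h' : Crosses F F' l' r') : l = l' ∧ r = r' := by
  obtain ⟨n, ν, σ, hb⟩ := exists_isBoundary F
  obtain ⟨i, hi, rfl, rfl, rfl⟩ := hb.exhaust h
  have := hb.unique hi h'
  exact ⟨this.1.symm, this.2.symm⟩

/-! ## The flow of a path -/

open Classical in
/-- The number of times `γ` steps from `F` to `F'`, for a path without loops. -/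
noncomputable def crossing (γ : ℤ → Face) (F F' : Face) : ℤ :=
  if ∃ t, γ t = F ∧ γ (t + 1) = F' then 1 else 0

/-- The number of steps of `γ` from `F` to `F'` minus the number of steps back. -/
noncomputable def netFlow (γ : ℤ → Face) (F F' : Face) : ℤ :=
  crossing γ F F' - crossing γ F' F

theorem netFlow_swap (γ : ℤ → Face) (F F' : Face) : netFlow γ F' F = -netFlow γ F F' := by
  simp [netFlow]

theorem IsPath.crossing_self {γ : ℤ → Face} (hγ : IsPath γ) (t : ℤ) (F' : Face)
    [Decidable (γ (t + 1) = F')] :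
    crossing γ (γ t) F' = if γ (t + 1) = F' then 1 else 0 := by
  classical
  have : (∃ s, γ s = γ t ∧ γ (s + 1) = F') ↔ γ (t + 1) = F' :=
    ⟨fun ⟨s, h, h'⟩ => by rwa [hγ.injective h] at h', fun h => ⟨t, rfl, h⟩⟩
  simp [crossing, this]

theorem IsPath.crossing_to {γ : ℤ → Face} (hγ : IsPath γ) (t : ℤ) (F' : Face)
    [Decidable (γ t = F')] :
    crossing γ F' (γ (t + 1)) = if γ t = F' then 1 else 0 := by
  classical
  have : (∃ s, γ s = F' ∧ γ (s + 1) = γ (t + 1)) ↔ γ t = F' :=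
    ⟨fun ⟨s, h, h'⟩ => by
      have := hγ.injective h'
      rwa [show s = t by omega] at h, fun h => ⟨t, h, rfl⟩⟩
  simp [crossing, this]

/-- Kirchhoff's law: `γ` has no ends, so it enters and leaves each visited face exactly once. -/
theorem IsBoundary.sum_netFlow {γ : ℤ → Face} (hγ : IsPath γ) {F : Face} {n : ℕ}
    {ν : ℕ → Vertex} {σ : ℕ → Face} (hb : IsBoundary F n ν σ) :
    ∑ j ∈ Finset.range n, netFlow γ F (σ j) = 0 := by
  classical
  by_cases hF : ∃ t, γ (t + 1) = F
  · obtain ⟨t, rfl⟩ := hF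
    have key : ∀ F', (∃ l r, Crosses (γ (t + 1)) F' l r) →
        ∑ j ∈ Finset.range n, (if F' = σ j then (1 : ℤ) else 0) = 1 := by
      rintro F' ⟨l, r, h⟩
      obtain ⟨i, hi, rfl, -, -⟩ := hb.exhaust h
      rw [Finset.sum_eq_single i]
      · simp
      · intro j hj hji
        rw [if_neg]
        exact fun h => hji (hb.injOn i hi j (Finset.mem_range.1 hj) h).symm
      · intro h
        exact absurd (Finset.mem_range.2 hi) h
    simp only [netFlow, Finset.sum_sub_distrib, hγ.crossing_self, hγ.crossing_to]
    rw [key _ (hγ.adjacent _), key, sub_self]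
    obtain ⟨l, r, h⟩ := hγ.adjacent t
    exact ⟨r, l, h.reverse⟩
  · refine Finset.sum_eq_zero fun j _ => ?_
    have h1 : ¬∃ t, γ t = F ∧ γ (t + 1) = σ j := fun ⟨t, h, _⟩ =>
      hF ⟨t - 1, by simpa using h⟩
    have h2 : ¬∃ t, γ t = σ j ∧ γ (t + 1) = F := fun ⟨t, _, h⟩ => hF ⟨t, h⟩
    simp [netFlow, crossing, h1, h2]

/-! ## A potential of the flow -/

/-- The values of `w` at the ends of every side differ by the flow across it. -/
def IsPotential (γ : ℤ → Face) (w : Vertex → ℤ) : Prop :=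
  ∀ F F' l r, Crosses F F' l r → w l - w r = netFlow γ F F'

theorem exists_antidifference (h : ℤ → ℤ) : ∃ H : ℤ → ℤ, ∀ n, H (n + 1) = H n + h n := by
  refine ⟨fun n => match n with
    | .ofNat m => ∑ i ∈ Finset.range m, h i
    | .negSucc m => -∑ i ∈ Finset.range (m + 1), h (-i - 1), fun n => ?_⟩
  match n with
  | .ofNat m => exact Finset.sum_range_succ (fun i : ℕ => h i) m
  | .negSucc 0 => simp
  | .negSucc (m + 1) =>
    have : Int.negSucc (m + 1) + 1 = Int.negSucc m := by omega
    rw [this]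
    simp only
    rw [Finset.sum_range_succ _ (m + 1)]
    have : -((m + 1 : ℕ) : ℤ) - 1 = Int.negSucc (m + 1) := by omega
    rw [this]
    ring

/-- Poincaré lemma on `ℤ²`: the circulation around unit squares vanishes, so summation along the
axis and then along a column is consistent. -/
theorem exists_potential_int (E₁ E₂ : ℤ → ℤ → ℤ)
    (h : ∀ j k, E₁ j k + E₂ (j + 1) k = E₂ j k + E₁ j (k + 1)) :
    ∃ V : ℤ → ℤ → ℤ, (∀ j k, V (j + 1) k = V j k + E₁ j k) ∧
      ∀ j k, V j (k + 1) = V j k + E₂ j k := by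
  obtain ⟨V₀, h₀⟩ := exists_antidifference fun j => E₁ j 0
  choose H hH using fun j => exists_antidifference (E₂ j)
  refine ⟨fun j k => V₀ j + (H j k - H j 0), fun j k => ?_, fun j k => by linarith [hH j k]⟩
  have : H (j + 1) k - H (j + 1) 0 - (H j k - H j 0) = E₁ j k - E₁ j 0 := by
    induction k with
    | zero => ring
    | succ n ih => linarith [hH (j + 1) n, hH j n, h j n]
    | pred n ih =>
      have h1 := hH (j + 1) (-n - 1)
      have h2 := hH j (-n - 1)
      have h3 := h j (-n - 1)
      rw [sub_add_cancel] at h1 h2 h3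
      linarith
  linarith [h₀ j]

/-- Poincaré lemma on the hexagonal lattice, reduced to `ℤ²` by following the `A` sites.
Antisymmetry expresses the circulation around a hexagon by edges that leave `A` sites. -/
theorem exists_site_potential (D : Site → Fin 3 → ℤ)
    (hback : ∀ x i, D (shift i x) (backLabel x i) = -D x i)
    (hhex : ∀ j k, D (.A j k) 0 - D (.A j k) 1 + (D (.A j (k - 1)) 1 - D (.A j (k - 1)) 2) +
      (D (.A (j + 1) (k - 1)) 2 - D (.A (j + 1) (k - 1)) 0) = 0) :
    ∃ u : Site → ℤ, ∀ x i, u (shift i x) = u x + D x i := by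
  -- The increments belong to the paths `A j (k)`, `B j k`, `A j (k+1)` and, continuing, `B (j+1)
  -- k`, `A (j+1) k`.
  obtain ⟨V, h₁, h₂⟩ := exists_potential_int
    (fun j k => D (.A j k) 2 - D (.A j (k + 1)) 0 - (D (.A (j + 1) k) 2 - D (.A j (k + 1)) 1))
    (fun j k => D (.A j k) 2 - D (.A j (k + 1)) 0) (fun j k => by
      have := hhex j (k + 1 + 1)
      rw [add_sub_cancel_right] at this
      linarith)
  have hA : ∀ j k i, (fun | .A j k => V j k | .B j k => V j k + D (.A j k) 2 : Site → ℤ)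
      (shift i (.A j k)) = V j k + D (.A j k) i := by
    intro j k i
    fin_cases i
    · have := h₂ j (k - 1)
      rw [sub_add_cancel] at this
      simp only [shift, shiftFun, Equiv.coe_fn_mk, Fin.zero_eta]
      linarith
    · have e1 := h₂ j (k - 1)
      have e2 := h₁ j (k - 1)
      rw [sub_add_cancel] at e1 e2
      simp only [shift, shiftFun, Equiv.coe_fn_mk, Fin.mk_one]
      linarith
    · rfl
  refine ⟨fun | .A j k => V j k | .B j k => V j k + D (.A j k) 2, fun x i => ?_⟩
  obtain ⟨j, k⟩ | ⟨j, k⟩ := x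
  · exact hA j k i
  · have h := hback (.B j k) i
    have hs := shift_backLabel (.B j k) i
    have : ∃ j' k', shift i (.B j k) = .A j' k' := by
      fin_cases i <;> exact ⟨_, _, rfl⟩
    obtain ⟨j', k', e⟩ := this
    rw [e] at h hs ⊢
    have := hA j' k' (backLabel (.B j k) i)
    rw [hs] at this
    linarith

theorem IsPath.netFlow_trapezoid {γ : ℤ → Face} (hγ : IsPath γ) (x : Site) (i : Fin 3) :
    netFlow γ (.trapezoid x i) (.para x i) +
      netFlow γ (.trapezoid x i) (.hexagon (plaquette x i)) +
      netFlow γ (.trapezoid x i) (.para x (i + 1)) +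
      netFlow γ (.trapezoid x i) (.triangle x) = 0 := by
  have := (isBoundary_trapezoid x i).sum_netFlow hγ
  simpa [Finset.sum_range_succ] using this

theorem IsPath.netFlow_triangle {γ : ℤ → Face} (hγ : IsPath γ) (x : Site) :
    netFlow γ (.trapezoid x 0) (.triangle x) + netFlow γ (.trapezoid x 1) (.triangle x) +
      netFlow γ (.trapezoid x 2) (.triangle x) = 0 := by
  have := (isBoundary_triangle x).sum_netFlow hγ
  simp only [Finset.sum_range_succ, Finset.sum_range_zero, netFlow_swap γ (.trapezoid _ _)] at this
  linarith

theorem IsPath.netFlow_para {γ : ℤ → Face} (hγ : IsPath γ) (x : Site) (i : Fin 3) :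
    netFlow γ (.trapezoid x i) (.para x i) + netFlow γ (.trapezoid x (i + 2)) (.para x i) +
      netFlow γ (.trapezoid (shift i x) (backLabel x i)) (.para x i) +
      netFlow γ (.trapezoid (shift i x) (backLabel x i + 2)) (.para x i) = 0 := by
  have := (isBoundary_para x i).sum_netFlow hγ
  simp only [Finset.sum_range_succ, Finset.sum_range_zero, netFlow_swap γ (.trapezoid _ _)] at this
  linarith

theorem IsPath.netFlow_hexagon {γ : ℤ → Face} (hγ : IsPath γ) (j k : ℤ) :
    netFlow γ (.trapezoid (.A j k) 0) (.hexagon (j, k)) +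
      netFlow γ (.trapezoid (.B j (k - 1)) 1) (.hexagon (j, k)) +
      netFlow γ (.trapezoid (.A j (k - 1)) 1) (.hexagon (j, k)) +
      netFlow γ (.trapezoid (.B (j + 1) (k - 2)) 2) (.hexagon (j, k)) +
      netFlow γ (.trapezoid (.A (j + 1) (k - 1)) 2) (.hexagon (j, k)) +
      netFlow γ (.trapezoid (.B (j + 1) (k - 1)) 0) (.hexagon (j, k)) = 0 := by
  have := (isBoundary_hexagon j k).sum_netFlow hγ
  simp only [Finset.sum_range_succ, Finset.sum_range_zero, netFlow_swap γ (.trapezoid _ _)] at this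
  linarith

theorem exists_label (d : DirEdge) : ∃ i, d = outEdge d.fst i := by
  obtain ⟨i, hi⟩ := d.adj
  exact ⟨i, SimpleGraph.Dart.ext _ _ (Prod.ext rfl hi.symm)⟩

theorem outEdge_injective : Function.Injective fun p : Site × Fin 3 => outEdge p.1 p.2 := by
  rintro ⟨x, i⟩ ⟨y, j⟩ h
  obtain rfl : x = y := congrArg (fun d : DirEdge => d.fst) h
  obtain rfl : i = j := shift_label_injective x (congrArg (fun d : DirEdge => d.snd) h)
  rfl

/-- The conservation law at each kind of face closes one kind of loop. Triangles and trapezoids fix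
the potential near a site up to a constant `u x`; parallelograms make the differences of these
constants antisymmetric; hexagons make them integrable. -/
theorem IsPath.exists_potential {γ : ℤ → Face} (hγ : IsPath γ) : ∃ w, IsPotential γ w := by
  set h : Site → Fin 3 → ℤ :=
    fun x i => netFlow γ (.trapezoid x i) (.hexagon (plaquette x i)) with h_def
  set p : Site → Fin 3 → ℤ := fun x i => netFlow γ (.trapezoid x i) (.para x i) with p_def
  set q : Site → Fin 3 → ℤ := fun x i => netFlow γ (.trapezoid x i) (.para x (i + 1)) with q_def
  set t : Site → Fin 3 → ℤ := fun x i => netFlow γ (.trapezoid x i) (.triangle x) with t_def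
  have htrap : ∀ x i, p x i + h x i + q x i + t x i = 0 := hγ.netFlow_trapezoid
  have htri : ∀ x, t x 0 + t x 1 + t x 2 = 0 := hγ.netFlow_triangle
  have h3 : ∀ i : Fin 3, i + 2 + 1 = i := by decide
  have hpara : ∀ x i, p x i + q x (i + 2) + p (shift i x) (backLabel x i) +
      q (shift i x) (backLabel x i + 2) = 0 := fun x i => by
    simp only [p_def, q_def, h3, para_backLabel]
    exact hγ.netFlow_para x i
  have hhex : ∀ j k, h (.A j k) 0 + h (.B j (k - 1)) 1 + h (.A j (k - 1)) 1 +
      h (.B (j + 1) (k - 2)) 2 + h (.A (j + 1) (k - 1)) 2 + h (.B (j + 1) (k - 1)) 0 = 0 :=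
    fun j k => by
      have key : ∀ x i, plaquette x i = (j, k) →
          h x i = netFlow γ (.trapezoid x i) (.hexagon (j, k)) := fun x i e => by
        simp only [h_def, e]
      rw [key (.A j k) 0, key (.B j (k - 1)) 1, key (.A j (k - 1)) 1,
        key (.B (j + 1) (k - 2)) 2, key (.A (j + 1) (k - 1)) 2, key (.B (j + 1) (k - 1)) 0]
      · exact hγ.netFlow_hexagon j k
      all_goals exact plaquette_eq_iff.2 (by simp)
  have eh : ∀ x i, netFlow γ (.trapezoid x i) (.hexagon (plaquette x i)) = h x i := fun _ _ => rfl
  have ep : ∀ x i, netFlow γ (.trapezoid x i) (.para x i) = p x i := fun _ _ => rfl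
  have eq : ∀ x i, netFlow γ (.trapezoid x i) (.para x (i + 1)) = q x i := fun _ _ => rfl
  have et : ∀ x i, netFlow γ (.trapezoid x i) (.triangle x) = t x i := fun _ _ => rfl
  clear_value h p q t
  -- Relative to `cross x 0`, `s` is the potential at `cross x i`, and below `α` and `β` are those
  -- at the outgoing and incoming edges.
  set s : Site → Fin 3 → ℤ := fun x => ![0, -t x 0, -t x 0 - t x 1] with s_def
  have hs : ∀ x i, s x (i + 1) = s x i - t x i := fun x i => by
    have := htri x
    fin_cases i
    · simp [s_def]
    · simp [s_def]
    · simp only [s_def]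
      change (0 : ℤ) = -t x 0 - t x 1 - t x 2
      linarith
  clear_value s
  set α : Site → Fin 3 → ℤ := fun x i => s x i - q x (i + 2) with α_def
  set β : Site → Fin 3 → ℤ := fun x i => s x i + p x i with β_def
  have hαβ : ∀ x i, α x (i + 1) - β x i = h x i := fun x i => by
    have e : i + 1 + 2 = i := by revert i; decide
    simp only [α_def, β_def, e]
    linarith [hs x i, htrap x i]
  have hback : ∀ x i, α x i - β x i + α (shift i x) (backLabel x i) -
      β (shift i x) (backLabel x i) = 0 := fun x i => by
    simp only [α_def, β_def]
    linarith [hpara x i]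
  obtain ⟨u, hu⟩ := exists_site_potential (fun x i => β x i - α (shift i x) (backLabel x i))
    (fun x i => by
      rw [shift_backLabel, backLabel_shift]
      linarith [hback x i]) (fun j k => by
      have b0 := hback (.A j k) 1
      have b1 := hback (.A j (k - 1)) 2
      have b2 := hback (.A (j + 1) (k - 1)) 0
      have a0 := hαβ (.A j k) 0
      have a1 := hαβ (.A j (k - 1)) 1
      have a2 := hαβ (.A (j + 1) (k - 1)) 2
      have c0 := hαβ (.B j (k - 1)) 1
      have c1 := hαβ (.B (j + 1) (k - 2)) 2
      have c2 := hαβ (.B (j + 1) (k - 1)) 0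
      have e := hhex j k
      have e1 : k - 1 - 1 = k - 2 := by ring
      simp only [shift, shiftFun, Equiv.coe_fn_mk, backLabel, Fin.isValue, Fin.reduceAdd,
        zero_add, e1] at *
      linarith)
  choose lab hlab using exists_label
  have hlab' : ∀ x i, lab (outEdge x i) = i := fun x i => by
    have := hlab (outEdge x i)
    exact (Prod.ext_iff.1 (outEdge_injective (a₁ := (x, i)) (a₂ := (x, lab (outEdge x i))) this)).2.symm
  -- An edge gets its value from its initial site; `hin` shows that the terminal site gives the same
  -- value.
  set w : Vertex → ℤ := fun
    | .edge d => u d.fst + α d.fst (lab d)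
    | .cross x i => u x + s x i with w_def
  have hout : ∀ x i, w (.edge (outEdge x i)) = u x + α x i := fun x i => by
    simp only [w_def, hlab']
    rfl
  have hin : ∀ x i, w (.edge (outEdge x i).symm) = u x + β x i := fun x i => by
    rw [← outEdge_backLabel, hout, hu]
    ring
  refine ⟨w, fun F F' l r hc => ?_⟩
  induction hc with
  | trapezoid_hexagon x i =>
    rw [hout, hin, eh]
    linarith [hαβ x i]
  | trapezoid_para x i =>
    rw [hin, ep]
    simp only [w_def, β_def]
    ring
  | trapezoid_para_succ x i =>
    have e : i + 1 + 2 = i := by revert i; decide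
    rw [hout, eq]
    simp only [w_def, α_def, e]
    ring
  | trapezoid_triangle x i =>
    rw [et]
    simp only [w_def, hs]
    ring
  | reverse _ ih =>
    rw [netFlow_swap, ← ih]
    ring

/-! ### The two sides of a path -/

theorem IsPotential.eq_of_joinedOff {γ : ℤ → Face} {w : Vertex → ℤ} (hw : IsPotential γ w)
    {p q : Vertex} (h : JoinedOff γ p q) : w p = w q := by
  obtain ⟨F, F', hc, hn⟩ := h
  have h1 : ¬∃ t, γ t = F ∧ γ (t + 1) = F' := fun ⟨t, h⟩ => (hn t).1 h
  have h2 : ¬∃ t, γ t = F' ∧ γ (t + 1) = F := fun ⟨t, h⟩ => (hn t).2 h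
  have := hw F F' p q hc
  simp only [netFlow, crossing, h1, h2, if_false, sub_zero] at this
  linarith

theorem IsPotential.eq_of_reflTransGen {γ : ℤ → Face} {w : Vertex → ℤ} (hw : IsPotential γ w)
    {p q : Vertex} (h : Relation.ReflTransGen (JoinedOff γ) p q) : w p = w q := by
  induction h with
  | refl => rfl
  | tail _ h ih => exact ih.trans (hw.eq_of_joinedOff h)

/-- A function on a cycle that changes at two places only. -/
theorem eq_of_cyclic {n : ℕ} (w : ℕ → ℤ) (hn : w n = w 0) {k m : ℕ} (hk : k < n) (hm : m < n)
    (hkm : k ≠ m) (hstep : ∀ j < n, j ≠ k → j ≠ m → w (j + 1) = w j) : w (k + 1) = w m := by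
  have key : ∀ a b, a ≤ b → b ≤ n → (∀ j, a ≤ j → j < b → j ≠ k ∧ j ≠ m) → w b = w a := by
    intro a b hab
    induction b, hab using Nat.le_induction with
    | base => intros; rfl
    | succ b hab ih =>
      intro hb h
      have := h b hab b.lt_succ_self
      rw [hstep b (by omega) this.1 this.2]
      exact ih (by omega) fun j h1 h2 => h j h1 (by omega)
  rcases lt_or_gt_of_ne hkm with h | h
  · exact (key (k + 1) m h hm.le fun j h1 h2 => by omega).symm
  · rw [← key (k + 1) n hk le_rfl fun j h1 h2 => by omega, hn,
      key 0 m (Nat.zero_le _) hm.le fun j h1 h2 => by omega]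

theorem IsPath.netFlow_step {γ : ℤ → Face} (hγ : IsPath γ) (t : ℤ) :
    netFlow γ (γ t) (γ (t + 1)) = 1 := by
  classical
  rw [netFlow, hγ.crossing_self, if_pos rfl, hγ.crossing_self (t + 1), if_neg, sub_zero]
  intro h
  have := hγ.injective h
  omega

/-- Along a path the left ends of the crossed sides have the same potential. -/
theorem IsPotential.left_succ {γ : ℤ → Face} (hγ : IsPath γ) {w : Vertex → ℤ}
    (hw : IsPotential γ w) {t : ℤ} {l r l' r' : Vertex} (h : Crosses (γ t) (γ (t + 1)) l r)
    (h' : Crosses (γ (t + 1)) (γ (t + 1 + 1)) l' r') : w l' = w l := by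
  classical
  obtain ⟨n, ν, σ, hb⟩ := exists_isBoundary (γ (t + 1))
  obtain ⟨m, hm, hσm, hνm, rfl⟩ := hb.exhaust h.reverse
  obtain ⟨k, hk, hσk, rfl, hνk⟩ := hb.exhaust h'
  rw [hνm.symm] at h
  -- On the boundary of `γ (t + 1)` only the sides of entry `m` and of exit `k` carry flow; they
  -- differ because `γ t ≠ γ (t + 2)`.
  refine eq_of_cyclic (fun j => w (ν j)) (congrArg w hb.closed) hk hm ?_ fun j hj hjk hjm => ?_
  · rintro rfl
    have := hγ.injective (hσm.symm.trans hσk)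
    omega
  · have := hw _ _ _ _ (hb.crosses j hj)
    rw [netFlow, hγ.crossing_self, hγ.crossing_to, if_neg, if_neg] at this
    · linarith
    · rw [← hσm]
      exact fun h => hjm (hb.injOn m hm j hj h).symm
    · rw [← hσk]
      exact fun h => hjk (hb.injOn k hk j hj h).symm

theorem IsPotential.exists_left {γ : ℤ → Face} (hγ : IsPath γ) {w : Vertex → ℤ}
    (hw : IsPotential γ w) :
    ∃ c, ∀ t l r, Crosses (γ t) (γ (t + 1)) l r → w l = c ∧ w r = c - 1 := by
  obtain ⟨l₀, r₀, h₀⟩ := hγ.adjacent 0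
  have key : ∀ t l r, Crosses (γ t) (γ (t + 1)) l r → w l = w l₀ := by
    intro t
    induction t with
    | zero =>
      intro l r h
      rw [(h.unique h₀).1]
    | succ n ih =>
      intro l r h
      obtain ⟨l', r', h'⟩ := hγ.adjacent n
      rw [hw.left_succ hγ h' h, ih _ _ h']
    | pred n ih =>
      intro l r h
      obtain ⟨l', r', h'⟩ := hγ.adjacent (-n)
      rw [← ih _ _ h']
      have e : (-n : ℤ) = -n - 1 + 1 := by ring
      rw [e] at h'
      exact (hw.left_succ hγ h h').symm
  refine ⟨w l₀, fun t l r h => ⟨key t l r h, ?_⟩⟩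
  have := hw _ _ _ _ h
  rw [hγ.netFlow_step, key t l r h] at this
  linarith

/-- The graph of vertices and sides is connected. -/
theorem vertex_induction {p : Vertex → Prop} {v₀ : Vertex} (h₀ : p v₀)
    (hs : ∀ F F' l r, Crosses F F' l r → p l → p r) : ∀ v, p v := by
  have h3 : ∀ i : Fin 3, i + 2 + 1 = i := by decide
  have hiff : ∀ {F F' l r}, Crosses F F' l r → (p l ↔ p r) := fun h =>
    ⟨hs _ _ _ _ h, hs _ _ _ _ h.reverse⟩
  have hcross : ∀ x i, p (.cross x i) ↔ p (.cross x 0) := by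
    intro x i
    have h0 := hiff (.trapezoid_triangle x 0)
    have h1 := hiff (.trapezoid_triangle x 1)
    fin_cases i
    · rfl
    · exact h0.symm
    · exact (h0.trans h1).symm
  have hin : ∀ x i, p (.edge (outEdge x i).symm) ↔ p (.cross x 0) := fun x i =>
    (hiff (.trapezoid_para x i)).trans (hcross x i)
  have hout : ∀ x i, p (.edge (outEdge x i)) ↔ p (.cross x 0) := fun x i => by
    have := hiff (.trapezoid_para_succ x (i + 2))
    rw [h3] at this
    exact this.symm.trans (hcross x i)
  have hedge : ∀ d : DirEdge, p (.edge d) ↔ p (.cross d.fst 0) := fun d => by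
    obtain ⟨i, hi⟩ := exists_label d
    conv_lhs => rw [hi]
    exact hout _ _
  have hsite : ∀ x, p (.cross x 0) := by
    have hstep : ∀ x i, p (.cross x 0) → p (.cross (shift i x) 0) := fun x i h => by
      rw [← hout _ (backLabel x i), outEdge_backLabel]
      exact (hin x i).2 h
    cases v₀ with
    | edge d => exact site_induction (p := fun x => p (.cross x 0)) ((hedge d).1 h₀) hstep
    | cross x i => exact site_induction (p := fun x => p (.cross x 0)) ((hcross x i).1 h₀) hstep
  intro v
  cases v with
  | edge d => exact (hedge d).2 (hsite _)
  | cross x i => exact (hcross x i).2 (hsite _)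

/-- The two sides of a path are the two level sets of the potential of its flow. -/
theorem IsPath.exists_levels {γ : ℤ → Face} (hγ : IsPath γ) :
    ∃ w, IsPotential γ w ∧ ∃ c : ℤ, (∀ d, d ∈ leftSide γ ↔ w (.edge d) = c) ∧
      ∀ d, d ∉ leftSide γ ↔ w (.edge d) = c - 1 := by
  obtain ⟨w, hw⟩ := hγ.exists_potential
  obtain ⟨c, hc⟩ := hw.exists_left hγ
  -- Every vertex lies on the left or on the right: moving along a side either avoids `γ`, or ends
  -- at an end point of a crossed side.
  have hall : ∀ v, ∃ t l r, Crosses (γ t) (γ (t + 1)) l r ∧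
      (Relation.ReflTransGen (JoinedOff γ) l v ∨ Relation.ReflTransGen (JoinedOff γ) r v) := by
    obtain ⟨l₀, r₀, h₀⟩ := hγ.adjacent 0
    refine vertex_induction (v₀ := l₀) ⟨0, l₀, r₀, h₀, .inl .refl⟩ ?_
    rintro F F' p q hpq ⟨t, l, r, h, hp⟩
    by_cases hcr : JoinedOff γ p q
    · exact ⟨t, l, r, h, hp.imp (·.tail hcr) (·.tail hcr)⟩
    · have : ∃ t, (γ t = F ∧ γ (t + 1) = F') ∨ (γ t = F' ∧ γ (t + 1) = F) := by
        by_contra hne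
        push Not at hne
        refine hcr ⟨F, F', hpq, fun t => ⟨fun h => (hne t).1 h.1 h.2, fun h => (hne t).2 h.1 h.2⟩⟩
      obtain ⟨t, ⟨rfl, rfl⟩ | ⟨rfl, rfl⟩⟩ := this
      · exact ⟨t, p, q, hpq, .inr .refl⟩
      · exact ⟨t, q, p, hpq.reverse, .inl .refl⟩
  have hmem : ∀ d, d ∈ leftSide γ → w (.edge d) = c := by
    rintro d ⟨t, l, r, h, hj⟩
    rw [← hw.eq_of_reflTransGen hj, (hc t l r h).1]
  have hnot : ∀ d, d ∉ leftSide γ → w (.edge d) = c - 1 := by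
    intro d hd
    obtain ⟨t, l, r, h, hj | hj⟩ := hall (.edge d)
    · exact absurd ⟨t, l, r, h, hj⟩ hd
    · rw [← hw.eq_of_reflTransGen hj, (hc t l r h).2]
  refine ⟨w, hw, c, fun d => ⟨hmem d, fun h => ?_⟩, fun d => ⟨hnot d, fun h h' => ?_⟩⟩
  · by_contra h'
    have := hnot d h'
    omega
  · have := hmem d h'
    omega

open Filter

/-! ## Counting edges on the left of a path -/

open Classical in
/-- The number of edges in `M` that leave `x` minus the number of those that enter `x`. -/
noncomputable def outMinusIn (M : Set DirEdge) (x : Site) : ℤ :=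
  ∑ i, ((if outEdge x i ∈ M then 1 else 0) - (if (outEdge x i).symm ∈ M then 1 else 0))

/-- Cyclically shifting the outgoing edges pairs `out (i + 1)` with `in i`, the ends of the side
between a trapezoid and its hexagon. -/
theorem IsPath.outMinusIn_leftSide {γ : ℤ → Face} (hγ : IsPath γ) (x : Site) :
    outMinusIn (leftSide γ) x =
      ∑ i, netFlow γ (.trapezoid x i) (.hexagon (plaquette x i)) := by
  classical
  obtain ⟨w, hw, c, hmem, hnot⟩ := hγ.exists_levels
  have hind : ∀ d, (if d ∈ leftSide γ then (1 : ℤ) else 0) = w (.edge d) - (c - 1) := fun d => by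
    split_ifs with h
    · rw [(hmem d).1 h]; ring
    · rw [(hnot d).1 h]; ring
  have h := fun i => hw _ _ _ _ (.trapezoid_hexagon x i)
  simp only [outMinusIn, hind, ← h, Fin.sum_univ_three]
  change _ = w (.edge (outEdge x 1)) - _ + (w (.edge (outEdge x 2)) - _) +
    (w (.edge (outEdge x 0)) - _)
  ring

open Classical in
/-- The indicator function of the hexagons. -/
noncomputable def hexInd (F : Face) : ℤ := if F.IsHexagon then 1 else 0

open Classical in
/-- The flow from the site `x` to the hexagons at time `t`. -/
noncomputable def flowAt (γ : ℤ → Face) (x : Site) (t : ℤ) : ℤ :=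
  ∑ i, ((if γ t = .trapezoid x i ∧ γ (t + 1) = .hexagon (plaquette x i) then 1 else 0) -
    (if γ t = .hexagon (plaquette x i) ∧ γ (t + 1) = .trapezoid x i then 1 else 0))

theorem hexInd_hexagon (p : ℤ × ℤ) : hexInd (.hexagon p) = 1 := if_pos ⟨p, rfl⟩

theorem hexInd_trapezoid (x : Site) (i : Fin 3) : hexInd (.trapezoid x i) = 0 :=
  if_neg fun ⟨_, h⟩ => nomatch h

theorem hexInd_triangle (x : Site) : hexInd (.triangle x) = 0 :=
  if_neg fun ⟨_, h⟩ => nomatch h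

theorem hexInd_parallelogram (e : hexLattice.edgeSet) : hexInd (.parallelogram e) = 0 :=
  if_neg fun ⟨_, h⟩ => nomatch h

theorem IsPath.exists_trapezoid {γ : ℤ → Face} (hγ : IsPath γ) (t : ℤ) :
    ∃ y i, γ t = .trapezoid y i ∨ γ (t + 1) = .trapezoid y i := by
  obtain ⟨l, r, h⟩ := hγ.adjacent t
  rw [crosses_iff, crossesFrom_iff, crossesFrom_iff] at h
  rcases h with ⟨y, i, h, -⟩ | ⟨y, i, h, -⟩
  · exact ⟨y, i, .inl h⟩
  · exact ⟨y, i, .inr h⟩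

open Classical in
-- Each move of `γ` involves one trapezoid, hence one site; there the flow into hexagons is the
-- increment of `hexInd`.
theorem IsPath.flowAt_eq {γ : ℤ → Face} (hγ : IsPath γ) {t : ℤ} {y : Site} {i : Fin 3}
    (h : γ t = .trapezoid y i ∨ γ (t + 1) = .trapezoid y i) (x : Site) :
    flowAt γ x t = if x = y then hexInd (γ (t + 1)) - hexInd (γ t) else 0 := by
  obtain ⟨l, r, hc⟩ := hγ.adjacent t
  rw [crosses_iff] at hc
  unfold flowAt
  rcases hc with hc | hc
  · generalize γ t = F at *
    generalize γ (t + 1) = F' at *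
    cases hc <;> simp only [reduceCtorEq, Face.para, or_false, Face.trapezoid.injEq, and_false,
      if_false, hexInd_hexagon, hexInd_trapezoid, hexInd_triangle,
      hexInd_parallelogram, sub_self, Finset.sum_const_zero, ite_self] at h ⊢
    obtain ⟨rfl, rfl⟩ := h
    rename_i x' i'
    by_cases hx : x = x'
    · subst hx
      rw [if_pos rfl, Finset.sum_eq_single i'] <;> simp +contextual [eq_comm]
    · have hx' : x' ≠ x := fun h => hx h.symm
      simp [hx, hx']
  · generalize γ t = F at *
    generalize γ (t + 1) = F' at *
    cases hc <;> simp only [reduceCtorEq, Face.para, false_or, Face.trapezoid.injEq, false_and,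
      and_false, if_false, hexInd_hexagon, hexInd_trapezoid, hexInd_triangle,
      hexInd_parallelogram, sub_self, Finset.sum_const_zero, ite_self] at h ⊢
    obtain ⟨rfl, rfl⟩ := h
    rename_i x' i'
    by_cases hx : x = x'
    · subst hx
      rw [if_pos rfl, Finset.sum_eq_single i'] <;> simp +contextual [eq_comm]
    · have hx' : x' ≠ x := fun h => hx h.symm
      simp [hx, hx']

theorem sum_Ico_int_succ (f : ℤ → ℤ) {a b : ℤ} (h : a ≤ b) :
    ∑ t ∈ Finset.Ico a (b + 1), f t = ∑ t ∈ Finset.Ico a b, f t + f b := by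
  rw [← Finset.insert_Ico_right_eq_Ico_add_one h, Finset.sum_insert (by simp), add_comm]

theorem sum_Ico_int_sub (g : ℤ → ℤ) {a b : ℤ} (h : a ≤ b) :
    ∑ t ∈ Finset.Ico a b, (g (t + 1) - g t) = g b - g a := by
  induction b, h using Int.leInduction with
  | base => simp
  | succ b hb ih => rw [sum_Ico_int_succ _ hb, ih]; ring

theorem sum_Ico_int_consecutive (f : ℤ → ℤ) {a b c : ℤ} (hab : a ≤ b) (hbc : b ≤ c) :
    ∑ t ∈ Finset.Ico a c, f t = ∑ t ∈ Finset.Ico a b, f t + ∑ t ∈ Finset.Ico b c, f t := by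
  induction c, hbc using Int.leInduction with
  | base => simp
  | succ c hc ih => rw [sum_Ico_int_succ _ (hab.trans hc), ih, sum_Ico_int_succ _ hc, add_assoc]

/-- A step between two hexagons or two parallelograms does not contribute to the flow. -/
theorem IsPath.sum_flowAt_step {γ : ℤ → Face} (hγ : IsPath γ) {s t : ℤ} (h : IsStep γ s t)
    (hs : ∀ y i, γ s ≠ .trapezoid y i) (ht : ∀ y i, γ t ≠ .trapezoid y i)
    (hst : hexInd (γ s) = hexInd (γ t)) (x : Site) :
    ∑ r ∈ Finset.Ico s t, flowAt γ x r = 0 := by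
  classical
  obtain ⟨hlt, x₀, hx₀⟩ := h
  -- The ends are not trapezoids, so every trapezoid met during the step belongs to `x₀`, and the
  -- sum telescopes.
  have : ∀ r ∈ Finset.Ico s t, flowAt γ x r =
      if x = x₀ then hexInd (γ (r + 1)) - hexInd (γ r) else 0 := by
    intro r hr
    rw [Finset.mem_Ico] at hr
    obtain ⟨y, i, h⟩ := hγ.exists_trapezoid r
    obtain rfl : y = x₀ := by
      rcases h with h | h
      · have hsr : s ≠ r := by rintro rfl; exact hs _ _ h
        have := hx₀ r (by omega) hr.2
        rwa [h] at this
      · have htr : r + 1 ≠ t := by rintro rfl; exact ht _ _ h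
        have := hx₀ (r + 1) (by omega) (by omega)
        rwa [h] at this
    exact hγ.flowAt_eq h x
  rw [Finset.sum_congr rfl this]
  split_ifs
  · rw [sum_Ico_int_sub (fun r => hexInd (γ r)) hlt.le, hst, sub_self]
  · exact Finset.sum_const_zero

theorem IsPath.sum_flowAt_hhStep {γ : ℤ → Face} (hγ : IsPath γ) {s t : ℤ} (h : IsHHStep γ s t)
    (x : Site) : ∑ r ∈ Finset.Ico s t, flowAt γ x r = 0 := by
  obtain ⟨h, ⟨p, hp⟩, ⟨q, hq⟩⟩ := h
  refine hγ.sum_flowAt_step h ?_ ?_ ?_ x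
  · rw [hp]; nofun
  · rw [hq]; nofun
  · rw [hp, hq, hexInd_hexagon, hexInd_hexagon]

theorem IsPath.sum_flowAt_ppStep {γ : ℤ → Face} (hγ : IsPath γ) {s t : ℤ} (h : IsPPStep γ s t)
    (x : Site) : ∑ r ∈ Finset.Ico s t, flowAt γ x r = 0 := by
  obtain ⟨h, ⟨p, hp⟩, ⟨q, hq⟩⟩ := h
  refine hγ.sum_flowAt_step h ?_ ?_ ?_ x
  · rw [hp]; nofun
  · rw [hq]; nofun
  · rw [hp, hq, hexInd_parallelogram, hexInd_parallelogram]

open Classical in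
-- A given crossing occurs at most once, so every sufficiently large time window sees it.
theorem IsPath.eventually_crossing {γ : ℤ → Face} (hγ : IsPath γ) (F F' : Face) :
    ∀ᶠ p : ℤ × ℤ in atBot ×ˢ atTop,
      crossing γ F F' = ∑ t ∈ Finset.Ico p.1 p.2, if γ t = F ∧ γ (t + 1) = F' then 1 else 0 := by
  by_cases h : ∃ t, γ t = F ∧ γ (t + 1) = F'
  · obtain ⟨t, rfl, rfl⟩ := h
    filter_upwards [(eventually_le_atBot t).prod_mk (eventually_gt_atTop t)] with p hp
    rw [hγ.crossing_self, if_pos rfl, Finset.sum_eq_single t]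
    · simp
    · intro s _ hs
      rw [if_neg]
      exact fun h => hs (hγ.injective h.1)
    · intro h
      exact absurd (Finset.mem_Ico.2 hp) h
  · refine .of_forall fun p => ?_
    rw [crossing, if_neg h, Finset.sum_eq_zero]
    intro t _
    rw [if_neg]
    exact fun ht => h ⟨t, ht⟩

theorem IsPath.eventually_sum_netFlow {γ : ℤ → Face} (hγ : IsPath γ) (x : Site) :
    ∀ᶠ p : ℤ × ℤ in atBot ×ˢ atTop,
      ∑ i, netFlow γ (.trapezoid x i) (.hexagon (plaquette x i)) =
        ∑ t ∈ Finset.Ico p.1 p.2, flowAt γ x t := by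
  classical
  have h := fun i : Fin 3 => (hγ.eventually_crossing (.trapezoid x i)
    (.hexagon (plaquette x i))).and (hγ.eventually_crossing
    (.hexagon (plaquette x i)) (.trapezoid x i))
  filter_upwards [eventually_all.2 h] with p hp
  unfold flowAt
  rw [Finset.sum_comm]
  refine Finset.sum_congr rfl fun i _ => ?_
  rw [netFlow, (hp i).1, (hp i).2, Finset.sum_sub_distrib]

theorem IsRelevant.exists_sum_outMinusIn {γ : ℤ → Face} (hγ : IsRelevant γ) :
    ∃ S₀ : Finset Site, ∀ S, S₀ ⊆ S → ∑ x ∈ S, outMinusIn (leftSide γ) x = -1 := by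
  classical
  have hp := hγ.toIsPath
  obtain ⟨N, ⟨a, ha, -, hh⟩, ⟨b, hb, -, pp⟩⟩ := hγ.tails
  have ha' : ∀ n : ℕ, a n ≤ a 0 - n := fun n => by
    induction n with
    | zero => simp
    | succ n ih => have := ha n.lt_add_one; push_cast; omega
  have hb' : ∀ n : ℕ, b 0 + n ≤ b n := fun n => by
    induction n with
    | zero => simp
    | succ n ih => have := hb n.lt_add_one; push_cast; omega
  -- The two tails may overlap, since `a 0 > b 0` is allowed; dropping some `hh`-steps separates
  -- them.
  obtain ⟨m, hm⟩ : ∃ m, a m ≤ b 0 := ⟨(a 0 - b 0).toNat, by have := ha' (a 0 - b 0).toNat; omega⟩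
  have hsite : ∀ x, outMinusIn (leftSide γ) x =
      ∑ t ∈ Finset.Ico (a m) (b 0), flowAt γ x t := by
    intro x
    have hta : Tendsto a atTop atBot := tendsto_atBot_mono ha'
      (tendsto_atBot_add_const_left _ _ (tendsto_neg_atTop_atBot.comp tendsto_natCast_atTop_atTop))
    have htb : Tendsto b atTop atTop := tendsto_atTop_mono hb'
      (tendsto_atTop_add_const_left _ _ tendsto_natCast_atTop_atTop)
    obtain ⟨n, hn⟩ := (((hta.comp (tendsto_add_atTop_nat m)).prodMk htb).eventually
      (hp.eventually_sum_netFlow x)).exists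
    rw [hp.outMinusIn_leftSide, hn]
    have h1 : ∀ n, ∑ t ∈ Finset.Ico (a (n + m)) (b 0), flowAt γ x t =
        ∑ t ∈ Finset.Ico (a m) (b 0), flowAt γ x t := fun n => by
      induction n with
      | zero => simp
      | succ n ih =>
        have e : n + 1 + m = n + m + 1 := by ring
        rw [e, sum_Ico_int_consecutive _ (ha (n + m).lt_succ_self).le
          ((ha.antitone (Nat.le_add_left m n)).trans hm), hp.sum_flowAt_hhStep (hh _), ih, zero_add]
    have h2 : ∀ n, ∑ t ∈ Finset.Ico (b 0) (b n), flowAt γ x t = 0 := fun n => by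
      induction n with
      | zero => simp
      | succ n ih =>
        rw [sum_Ico_int_consecutive _ (hb.monotone n.zero_le) (hb n.lt_succ_self).le,
          hp.sum_flowAt_ppStep (pp _), ih, zero_add]
    rw [Function.comp_apply, sum_Ico_int_consecutive _
      ((ha.antitone (Nat.le_add_left m n)).trans hm) (hb.monotone n.zero_le), h1, h2, add_zero]
  choose y i hy using hp.exists_trapezoid
  -- `S₀` consists of the sites that `γ` passes in the remaining window; at all others the flow is
  -- zero.
  refine ⟨(Finset.Ico (a m) (b 0)).image y, fun S hS => ?_⟩
  rw [Finset.sum_congr rfl fun x _ => hsite x, Finset.sum_comm]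
  have : ∀ t ∈ Finset.Ico (a m) (b 0), ∑ x ∈ S, flowAt γ x t =
      hexInd (γ (t + 1)) - hexInd (γ t) := by
    intro t ht
    simp only [hp.flowAt_eq (hy t)]
    rw [Finset.sum_ite_eq', if_pos (hS (Finset.mem_image_of_mem y ht))]
  rw [Finset.sum_congr rfl this, sum_Ico_int_sub (fun t => hexInd (γ t)) hm]
  obtain ⟨p, h0⟩ := (hh m).2.2
  obtain ⟨e, h1⟩ := (pp 0).2.1
  rw [h0, h1, hexInd_hexagon, hexInd_parallelogram]
  rfl

/-! ### Differences of projections and the stability of their index -/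

section Index

variable {H : Type} [NormedAddCommGroup H] [InnerProductSpace ℂ H]

theorem inner_apply_self_of_isStarProjection [CompleteSpace H] {p : H →L[ℂ] H}
    (hp : IsStarProjection p) (v : H) : inner ℂ (p v) v = (‖p v‖ : ℂ) ^ 2 := by
  have h1 : p (p v) = p v := congrArg (fun f : H →L[ℂ] H => f v) hp.isIdempotentElem
  have h2 := (ContinuousLinearMap.isSelfAdjoint_iff_isSymmetric.1 hp.isSelfAdjoint) (p v) v
  simp only [ContinuousLinearMap.coe_coe, h1] at h2
  rw [h2, inner_self_eq_norm_sq_to_K]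
  rfl

/-- The eigenvectors of a difference of projections for the eigenvalue `1`. -/
theorem mem_eigenspace_sub_iff [CompleteSpace H] {p q : H →L[ℂ] H} (hp : IsStarProjection p)
    (hq : IsStarProjection q) (v : H) :
    v ∈ Module.End.eigenspace ((p - q : H →L[ℂ] H) : H →ₗ[ℂ] H) 1 ↔ p v = v ∧ q v = 0 := by
  rw [Module.End.mem_eigenspace_iff]
  simp only [ContinuousLinearMap.coe_coe, sub_apply, one_smul]
  constructor
  · intro h
    -- Together with `‖p v‖ ≤ ‖v‖` this forces `q v = 0`.
    have h1 : ‖p v‖ ^ 2 - ‖q v‖ ^ 2 = ‖v‖ ^ 2 := by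
      have e := congrArg (fun u => inner ℂ u v) h
      simp only [inner_sub_left, inner_apply_self_of_isStarProjection hp,
        inner_apply_self_of_isStarProjection hq, inner_self_eq_norm_sq_to_K] at e
      apply Complex.ofReal_injective
      push_cast
      exact e
    have h2 : ‖p v‖ ≤ ‖v‖ := by
      have h3 : ‖p v‖ ^ 2 ≤ ‖p v‖ * ‖v‖ := by
        have := norm_inner_le_norm (𝕜 := ℂ) (p v) v
        rw [inner_apply_self_of_isStarProjection hp] at this
        simpa using this
      rcases (norm_nonneg (p v)).eq_or_lt with h0 | h0
      · rw [← h0]; exact norm_nonneg v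
      · nlinarith
    have h3 : q v = 0 := by
      have := norm_nonneg (p v)
      rw [← norm_eq_zero, ← sq_eq_zero_iff]
      nlinarith [sq_nonneg ‖q v‖]
    exact ⟨by rwa [h3, sub_zero] at h, h3⟩
  · rintro ⟨h1, h2⟩
    rw [h1, h2, sub_zero]

/-- The index of a pair of projections of finite rank is the difference of their ranks. -/
theorem fluxIndex_sub [CompleteSpace H] {p q : H →L[ℂ] H} (hp : IsStarProjection p)
    (hq : IsStarProjection q) [FiniteDimensional ℂ (LinearMap.range (p : H →ₗ[ℂ] H))]
    [FiniteDimensional ℂ (LinearMap.range (q : H →ₗ[ℂ] H))] :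
    fluxIndex (p - q) = (Module.finrank ℂ (LinearMap.range (p : H →ₗ[ℂ] H)) : ℤ) -
      Module.finrank ℂ (LinearMap.range (q : H →ₗ[ℂ] H)) := by
  set K := LinearMap.range (p : H →ₗ[ℂ] H) with hK
  set L := LinearMap.range (q : H →ₗ[ℂ] H) with hL
  have hpK : ∀ v : K, p v = v := by
    rintro ⟨_, v, rfl⟩
    exact congrArg (fun f : H →L[ℂ] H => f v) hp.isIdempotentElem
  have hqL : ∀ v : L, q v = v := by
    rintro ⟨_, v, rfl⟩
    exact congrArg (fun f : H →L[ℂ] H => f v) hq.isIdempotentElem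
  -- The eigenspaces for `1` and `-1` are the kernels of `T` and of its adjoint `T'`, so the claim
  -- is the index formula for a map between spaces of finite dimension.
  let T : K →ₗ[ℂ] L := (q : H →ₗ[ℂ] H).rangeRestrict ∘ₗ K.subtype
  let T' : L →ₗ[ℂ] K := (p : H →ₗ[ℂ] H).rangeRestrict ∘ₗ L.subtype
  have hT' : T' = T.adjoint := by
    rw [LinearMap.eq_adjoint_iff]
    intro u v
    change inner ℂ (p u) (v : H) = inner ℂ (u : H) (q v)
    have h1 := (ContinuousLinearMap.isSelfAdjoint_iff_isSymmetric.1 hp.isSelfAdjoint) (u : H) v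
    have h2 := (ContinuousLinearMap.isSelfAdjoint_iff_isSymmetric.1 hq.isSelfAdjoint) (u : H) v
    simp only [ContinuousLinearMap.coe_coe, hpK, hqL] at h1 h2
    rw [h1, h2]
  have e1 : Module.End.eigenspace ((p - q : H →L[ℂ] H) : H →ₗ[ℂ] H) 1 =
      (LinearMap.ker T).map K.subtype := by
    ext v
    rw [mem_eigenspace_sub_iff hp hq, Submodule.mem_map]
    constructor
    · rintro ⟨h1, h2⟩
      exact ⟨⟨v, v, h1⟩, Subtype.ext h2, rfl⟩
    · rintro ⟨u, hu, rfl⟩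
      exact ⟨hpK u, congrArg Subtype.val hu⟩
  have e2 : Module.End.eigenspace ((p - q : H →L[ℂ] H) : H →ₗ[ℂ] H) (-1) =
      (LinearMap.ker T').map L.subtype := by
    have : Module.End.eigenspace ((p - q : H →L[ℂ] H) : H →ₗ[ℂ] H) (-1) =
        Module.End.eigenspace ((q - p : H →L[ℂ] H) : H →ₗ[ℂ] H) 1 := by
      ext v
      simp only [Module.End.mem_eigenspace_iff, ContinuousLinearMap.coe_coe,
        sub_apply, one_smul, neg_smul]
      rw [← neg_sub (q v), neg_inj]
    rw [this]
    ext v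
    rw [mem_eigenspace_sub_iff hq hp, Submodule.mem_map]
    constructor
    · rintro ⟨h1, h2⟩
      exact ⟨⟨v, v, h1⟩, Subtype.ext h2, rfl⟩
    · rintro ⟨u, hu, rfl⟩
      exact ⟨hqL u, congrArg Subtype.val hu⟩
  have r1 := LinearMap.finrank_range_add_finrank_ker T
  have r2 := Submodule.finrank_add_finrank_orthogonal (LinearMap.range T)
  rw [LinearMap.orthogonal_range, ← hT'] at r2
  rw [fluxIndex, e1, e2, Submodule.finrank_map_subtype_eq, Submodule.finrank_map_subtype_eq]
  omega

/-- An operator of finite rank has finite spectrum. -/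
theorem finite_spectrum_of_finiteDimensional_range (A : H →L[ℂ] H)
    [FiniteDimensional ℂ (LinearMap.range (A : H →ₗ[ℂ] H))] : (spectrum ℂ A).Finite := by
  set K := LinearMap.range (A : H →ₗ[ℂ] H)
  let f : K →ₗ[ℂ] K := (A : H →ₗ[ℂ] H).rangeRestrict ∘ₗ K.subtype
  have hf : ∀ (g : Polynomial ℂ) (v : K),
      (Polynomial.aeval f g v : H) = Polynomial.aeval A g (v : H) := by
    intro g
    induction g using Polynomial.induction_on with
    | C a => intro v; simp [Algebra.algebraMap_eq_smul_one]
    | add g h hg hh => intro v; simp [hg, hh]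
    | monomial n a ih =>
      intro v
      rw [pow_succ, ← mul_assoc, map_mul _ (_ * _), map_mul _ (_ * _), Polynomial.aeval_X,
        Polynomial.aeval_X]
      exact ih (f v)
  -- The factor `X` first maps into the range of `A`, where the minimal polynomial of the
  -- restriction `f` annihilates; the spectrum lies among the roots of `g`.
  set g := minpoly ℂ f * Polynomial.X with hg
  have hg0 : g ≠ 0 := mul_ne_zero (minpoly.ne_zero (Algebra.IsIntegral.isIntegral f)) Polynomial.X_ne_zero
  have hgA : Polynomial.aeval A g = 0 := by
    ext v
    rw [hg, map_mul, Polynomial.aeval_X]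
    have := hf (minpoly ℂ f) ⟨A v, v, rfl⟩
    rw [minpoly.aeval] at this
    exact this.symm
  refine (g.rootSet_finite ℂ).subset fun z hz => ?_
  have := spectrum.subset_polynomial_aeval A g ⟨z, hz, rfl⟩
  rw [hgA] at this
  rcases subsingleton_or_nontrivial H with h | h
  · exact absurd hz (by simp [spectrum.of_subsingleton])
  · rw [spectrum.zero_eq, Set.mem_singleton_iff] at this
    rw [Polynomial.mem_rootSet]
    exact ⟨hg0, by simpa [Polynomial.aeval_def] using this⟩

/-- Since `a e` and `a (1 - e)` multiply to zero, `(z - a e)(z - a (1 - e)) = z (z - a)`. -/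
theorem spectrum_subset_of_commute {A : Type*} [Ring A] [Algebra ℂ A] {a e : A}
    (he : IsIdempotentElem e) (hc : Commute a e) {z : ℂ} (hz : z ≠ 0) (h : z ∈ spectrum ℂ a) :
    z ∈ spectrum ℂ (a * e) ∨ z ∈ spectrum ℂ (a * (1 - e)) := by
  by_contra! hcon
  obtain ⟨h1, h2⟩ := hcon
  rw [spectrum.notMem_iff] at h1 h2
  refine h ?_
  have e0 : a * e * (a * (1 - e)) = 0 := by
    have : e * a = a * e := hc.symm
    rw [mul_assoc, ← mul_assoc e, this, mul_assoc a e, mul_sub, mul_one, he.eq, sub_self, mul_zero,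
      mul_zero]
  have key : (algebraMap ℂ A z - a * e) * (algebraMap ℂ A z - a * (1 - e)) =
      algebraMap ℂ A z * (algebraMap ℂ A z - a) := by
    rw [sub_mul, mul_sub (a * e), e0, ← Algebra.commutes z (a * e)]
    noncomm_ring
  have hu := h1.mul h2
  rw [key] at hu
  have hz' : IsUnit (algebraMap ℂ A z) := (IsUnit.mk0 z hz).map _
  exact hz'.mul_left_iff.1 hu

variable {Φ e : H →L[ℂ] H}

/-- Eigenvectors for eigenvalues on the unit circle lie in the range of `e`, if `Φ` commutes with
`e` and has norm less than one on the kernel of `e`. -/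
theorem apply_eq_of_eigenvector (hc : Commute Φ e) (he : IsIdempotentElem e)
    (hΦ : ‖Φ * (1 - e)‖ < 1) {z : ℂ} (hz : ‖z‖ = 1) {v : H} (hv : Φ v = z • v) : e v = v := by
  have h1 : (Φ * (1 - e)) ((1 - e) v) = z • (1 - e) v := by
    have : Φ * (1 - e) * (1 - e) = (1 - e) * Φ := by
      rw [mul_assoc, he.one_sub.eq, mul_sub, sub_mul, mul_one, one_mul, hc.eq]
    calc (Φ * (1 - e) * (1 - e)) v = ((1 - e) * Φ) v := by rw [this]
      _ = (1 - e) (Φ v) := rfl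
      _ = z • (1 - e) v := by rw [hv, map_smul]
  have h2 := (Φ * (1 - e)).le_opNorm ((1 - e) v)
  rw [h1, norm_smul, hz, one_mul] at h2
  have h3 : (1 - e) v = 0 := by
    rw [← norm_eq_zero]
    nlinarith [norm_nonneg ((1 - e) v)]
  exact (sub_eq_zero.1 h3).symm

theorem eigenspace_mul_eq (hc : Commute Φ e) (he : IsIdempotentElem e)
    (hΦ : ‖Φ * (1 - e)‖ < 1) {z : ℂ} (hz : ‖z‖ = 1) :
    Module.End.eigenspace ((Φ * e : H →L[ℂ] H) : H →ₗ[ℂ] H) z =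
      Module.End.eigenspace (Φ : H →ₗ[ℂ] H) z := by
  ext v
  simp only [Module.End.mem_eigenspace_iff, ContinuousLinearMap.coe_coe]
  change Φ (e v) = _ ↔ _
  constructor
  · intro h
    have hz0 : z ≠ 0 := by rintro rfl; simp at hz
    have h1 : e v = v := by
      have h2 : e (Φ (e v)) = Φ (e v) := by
        have : e * (Φ * e) = Φ * e := by rw [← mul_assoc, ← hc.eq, mul_assoc, he.eq]
        exact congrArg (fun f : H →L[ℂ] H => f v) this
      rw [h, map_smul] at h2
      exact smul_right_injective H hz0 h2
    rwa [h1] at h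
  · intro h
    rw [apply_eq_of_eigenvector hc he hΦ hz h, h]

theorem fluxIndex_mul_eq (hc : Commute Φ e) (he : IsIdempotentElem e)
    (hΦ : ‖Φ * (1 - e)‖ < 1) : fluxIndex (Φ * e) = fluxIndex Φ := by
  rw [fluxIndex, eigenspace_mul_eq hc he hΦ (by simp), eigenspace_mul_eq hc he hΦ (by simp),
    fluxIndex]

theorem exists_gap_of_finite {s : Set ℂ} (hs : s.Finite) :
    ∃ ε : ℝ, 0 < ε ∧ ∀ z ∈ s, z ≠ 1 → ε ≤ ‖z - 1‖ := by
  obtain ⟨ε, hε, h⟩ := Metric.isOpen_iff.1 (hs.subset (Set.sdiff_subset (t := {1}))).isClosed.isOpen_compl 1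
    (by simp)
  refine ⟨ε, hε, fun z hz hz1 => ?_⟩
  by_contra! hlt
  exact h (a := z) (by rwa [Metric.mem_ball, dist_eq_norm]) ⟨hz, hz1⟩

/-- A nonzero index yields an eigenvector of `Φ` for `1` or `-1`, hence one of `Φ²` for `1`; all of
these lie in the range of `e`. Apart from `0`, the spectrum of `Φ²` is contained in a finite set
together with a disk of radius less than one. -/
theorem indexDefined_of_commute [CompleteSpace H] (hc : Commute Φ e) (he : IsIdempotentElem e)
    [FiniteDimensional ℂ (LinearMap.range (e : H →ₗ[ℂ] H))]
    (hΦ : ‖Φ * (1 - e)‖ < 1) (hne : fluxIndex Φ ≠ 0) : IndexDefined Φ := by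
  have hc2 : Commute (Φ ^ 2) e := hc.pow_left 2
  have hmul : Φ ^ 2 * (1 - e) = Φ * (1 - e) * (Φ * (1 - e)) := by
    have h1 : Commute Φ (1 - e) := (Commute.one_right _).sub_right hc
    rw [mul_assoc, ← mul_assoc (1 - e), ← h1.eq, mul_assoc, he.one_sub.eq, ← mul_assoc, sq]
  have hΦ2 : ‖Φ ^ 2 * (1 - e)‖ < 1 := by
    rw [hmul]
    refine (norm_mul_le _ _).trans_lt ?_
    nlinarith [norm_nonneg (Φ * (1 - e))]
  refine ⟨?_, ?_, ?_⟩
  · by_contra hcon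
    have hbot : Module.End.eigenspace ((Φ ^ 2 : H →L[ℂ] H) : H →ₗ[ℂ] H) 1 = ⊥ := by
      by_contra h
      exact hcon h
    have h1 : ∀ z : ℂ, z * z = 1 → Module.End.eigenspace (Φ : H →ₗ[ℂ] H) z = ⊥ := by
      intro z hz
      rw [eq_bot_iff, ← hbot]
      intro v hv
      rw [Module.End.mem_eigenspace_iff] at hv ⊢
      change Φ v = _ at hv
      rw [sq]
      change Φ (Φ v) = _
      rw [hv, map_smul, hv, smul_smul, hz]
    apply hne
    rw [fluxIndex, h1 1 (by norm_num), h1 (-1) (by norm_num)]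
    simp
  · refine Submodule.finiteDimensional_of_le (S₂ := LinearMap.range (e : H →ₗ[ℂ] H)) ?_
    intro v hv
    rw [Module.End.mem_eigenspace_iff] at hv
    exact ⟨v, apply_eq_of_eigenvector hc2 he hΦ2 (z := 1) (by simp) hv⟩
  · have : FiniteDimensional ℂ (LinearMap.range ((Φ ^ 2 * e : H →L[ℂ] H) : H →ₗ[ℂ] H)) := by
      have : ((Φ ^ 2 * e : H →L[ℂ] H) : H →ₗ[ℂ] H) =
          ((Φ ^ 2 : H →L[ℂ] H) : H →ₗ[ℂ] H) ∘ₗ (e : H →ₗ[ℂ] H) := rfl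
      rw [this, LinearMap.range_comp]
      infer_instance
    obtain ⟨ε, hε, h⟩ := exists_gap_of_finite (finite_spectrum_of_finiteDimensional_range (Φ ^ 2 * e))
    -- The distances of `1` from `0`, from the rest of the finite spectrum, and from the disk.
    refine ⟨min 1 (min ε (1 - ‖Φ ^ 2 * (1 - e)‖)), by simp [hε, hΦ2], fun z hz hz1 => ?_⟩
    rcases eq_or_ne z 0 with rfl | hz0
    · simp
    rcases spectrum_subset_of_commute he hc2 hz0 hz with h' | h'
    · exact ((min_le_right _ _).trans (min_le_left _ _)).trans (h z h' hz1)
    · refine ((min_le_right _ _).trans (min_le_right _ _)).trans ?_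
      have h2 : ‖z‖ ≤ ‖Φ ^ 2 * (1 - e)‖ := by
        refine (spectrum.norm_le_norm_mul_of_mem h').trans ?_
        exact mul_le_of_le_one_right (norm_nonneg _) ContinuousLinearMap.norm_id_le
      have h3 := norm_sub_norm_le (1 : ℂ) z
      rw [norm_one, norm_sub_rev] at h3
      linarith

end Index

/-! ## Coordinate projections -/

section Proj

variable {ι : Type}

open Classical in
theorem proj_apply (s : Set ι) (ψ : L2 ι) (d : ι) : proj s ψ d = if d ∈ s then ψ d else 0 := by
  change (if d ∈ s then (1 : ℂ) else 0) * ψ d = _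
  split_ifs <;> simp

theorem proj_mul (s t : Set ι) : proj s * proj t = proj (s ∩ t) := by
  ext ψ d
  change proj s (proj t ψ) d = _
  simp only [proj_apply, Set.mem_inter_iff]
  split_ifs <;> simp_all

theorem isStarProjection_proj (s : Set ι) : IsStarProjection (proj s) where
  isIdempotentElem := by rw [IsIdempotentElem, proj_mul, Set.inter_self]
  isSelfAdjoint := by
    rw [ContinuousLinearMap.isSelfAdjoint_iff_isSymmetric]
    intro ψ φ
    change inner ℂ (proj s ψ) φ = inner ℂ ψ (proj s φ)
    rw [lp.inner_eq_tsum, lp.inner_eq_tsum]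
    refine tsum_congr fun d => ?_
    rw [proj_apply, proj_apply]
    split_ifs <;> simp

theorem norm_proj_le (s : Set ι) : ‖proj s‖ ≤ 1 := by
  unfold proj diagOp
  exact LinearMap.mkContinuous_norm_le _ zero_le_one _

theorem nonempty_range_proj_equiv (s : Set ι) (hs : s.Finite) :
    Nonempty (LinearMap.range (proj s : L2 ι →ₗ[ℂ] L2 ι) ≃ₗ[ℂ] (s → ℂ)) := by
  classical
  have hfix : ∀ ψ : LinearMap.range (proj s : L2 ι →ₗ[ℂ] L2 ι), proj s (ψ : L2 ι) = ψ := by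
    rintro ⟨_, ψ, rfl⟩
    exact congrArg (fun f : L2 ι →L[ℂ] L2 ι => f ψ) (isStarProjection_proj s).isIdempotentElem
  let f : LinearMap.range (proj s : L2 ι →ₗ[ℂ] L2 ι) →ₗ[ℂ] (s → ℂ) :=
    { toFun := fun ψ i => (ψ : L2 ι) i
      map_add' := fun _ _ => rfl
      map_smul' := fun _ _ => rfl }
  refine ⟨LinearEquiv.ofBijective f ⟨?_, fun v => ?_⟩⟩
  · intro ψ φ h
    apply Subtype.ext
    rw [← hfix ψ, ← hfix φ]
    ext d
    rw [proj_apply, proj_apply]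
    split_ifs with hd
    · exact congrFun h ⟨d, hd⟩
    · rfl
  · have hmem : Memℓp (fun d => if h : d ∈ s then v ⟨d, h⟩ else 0) 2 := by
      refine memℓp_gen (summable_of_ne_finset_zero (s := hs.toFinset) fun d hd => ?_)
      rw [Set.Finite.mem_toFinset] at hd
      simp [hd]
    refine ⟨⟨proj s ⟨_, hmem⟩, ⟨_, rfl⟩⟩, ?_⟩
    funext i
    change proj s ⟨_, hmem⟩ (i : ι) = _
    rw [proj_apply, if_pos i.2]
    exact dif_pos i.2

theorem finiteDimensional_range_proj (s : Set ι) (hs : s.Finite) :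
    FiniteDimensional ℂ (LinearMap.range (proj s : L2 ι →ₗ[ℂ] L2 ι)) := by
  obtain ⟨e⟩ := nonempty_range_proj_equiv s hs
  have := hs.to_subtype
  exact e.symm.finiteDimensional

theorem finrank_range_proj (s : Set ι) (hs : s.Finite) :
    Module.finrank ℂ (LinearMap.range (proj s : L2 ι →ₗ[ℂ] L2 ι)) = s.ncard := by
  obtain ⟨e⟩ := nonempty_range_proj_equiv s hs
  have := hs.fintype
  rw [e.finrank_eq, Module.finrank_fintype_fun_eq_card, ← Nat.card_coe_set_eq,
    Nat.card_eq_fintype_card]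

theorem hasSum_norm_sq (ψ : L2 ι) : HasSum (fun d => ‖ψ d‖ ^ 2) (‖ψ‖ ^ 2) := by
  have := lp.hasSum_norm (p := 2) (by norm_num) ψ
  simpa using this

/-- The norm of `ψ` is determined by the norms of its parts on the fibres of `f`. -/
theorem hasSum_norm_sq_proj {κ : Type} (f : ι → κ) (ψ : L2 ι) :
    HasSum (fun x => ‖proj {d | f d = x} ψ‖ ^ 2) (‖ψ‖ ^ 2) := by
  have h := (Equiv.sigmaFiberEquiv f).hasSum_iff.2 (hasSum_norm_sq ψ)
  refine h.sigma fun x => ?_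
  have h1 := hasSum_norm_sq (proj {d | f d = x} ψ)
  have h2 : (fun d => ‖proj {d | f d = x} ψ d‖ ^ 2) =
      Set.indicator {d | f d = x} fun d => ‖ψ d‖ ^ 2 := by
    classical
    funext d
    rw [proj_apply, Set.indicator_apply]
    split_ifs <;> simp
  rw [h2, ← hasSum_subtype_iff_indicator] at h1
  exact h1

/-- The norm of a block diagonal operator. -/
theorem norm_le_of_commute_proj {κ : Type} (f : ι → κ) (A : L2 ι →L[ℂ] L2 ι)
    (hA : ∀ x, Commute A (proj {d | f d = x})) {c : ℝ} (hc : 0 ≤ c)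
    (h : ∀ x, ‖A * proj {d | f d = x}‖ ≤ c) : ‖A‖ ≤ c := by
  refine ContinuousLinearMap.opNorm_le_bound _ hc fun ψ => ?_
  refine le_of_sq_le_sq ?_ (by positivity)
  rw [mul_pow]
  refine hasSum_le (fun x => ?_) (hasSum_norm_sq_proj f (A ψ))
    ((hasSum_norm_sq_proj f ψ).mul_left (c ^ 2))
  rw [← mul_pow]
  refine pow_le_pow_left₀ (norm_nonneg _) ?_ 2
  have e : proj {d | f d = x} (A ψ) = (A * proj {d | f d = x}) (proj {d | f d = x} ψ) := by
    have : proj {d | f d = x} * A = A * proj {d | f d = x} * proj {d | f d = x} := by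
      rw [mul_assoc, (isStarProjection_proj _).isIdempotentElem.eq, (hA x).eq]
    exact congrArg (fun g : L2 ι →L[ℂ] L2 ι => g ψ) this
  rw [e]
  exact (A * proj {d | f d = x}).le_of_opNorm_le (h x) _

end Proj

/-! ## The walk is unitary and local -/

theorem sum_norm_sq_mulVec (C : Matrix.unitaryGroup (Fin 3) ℂ) (v : Fin 3 → ℂ) :
    ∑ i, ‖∑ j, (C : Matrix (Fin 3) (Fin 3) ℂ) i j * v j‖ ^ 2 = ∑ i, ‖v i‖ ^ 2 := by
  have key : ∀ u : Fin 3 → ℂ, ((∑ i, ‖u i‖ ^ 2 : ℝ) : ℂ) = star u ⬝ᵥ u := fun u => by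
    simp [dotProduct, Complex.conj_mul']
  apply Complex.ofReal_injective
  rw [key v]
  refine (key ((C : Matrix (Fin 3) (Fin 3) ℂ).mulVec v)).trans ?_
  rw [Matrix.star_mulVec, Matrix.dotProduct_mulVec, Matrix.vecMul_vecMul,
    ← Matrix.star_eq_conjTranspose, Matrix.UnitaryGroup.star_mul_self, Matrix.vecMul_one]

theorem coinOp_coinOp {C D : Site → Matrix.unitaryGroup (Fin 3) ℂ} (h : ∀ x, C x * D x = 1)
    (ψ : L2 (Site × Fin 3)) : coinOp C (coinOp D ψ) = ψ := by
  ext ⟨x, i⟩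
  simp only [coinOp_apply]
  have h1 := congrFun (Matrix.mulVec_mulVec (fun j => ψ (x, j))
    (C x : Matrix (Fin 3) (Fin 3) ℂ) (D x : Matrix (Fin 3) (Fin 3) ℂ)) i
  have h2 : (C x : Matrix (Fin 3) (Fin 3) ℂ) * (D x : Matrix (Fin 3) (Fin 3) ℂ) = 1 :=
    congrArg Subtype.val (h x)
  rw [h2, Matrix.one_mulVec] at h1
  exact h1

theorem norm_coinOp (C : Site → Matrix.unitaryGroup (Fin 3) ℂ) (ψ : L2 (Site × Fin 3)) :
    ‖coinOp C ψ‖ = ‖ψ‖ := by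
  have key : ∀ φ : L2 (Site × Fin 3), HasSum (fun x => ∑ i, ‖φ (x, i)‖ ^ 2) (‖φ‖ ^ 2) :=
    fun φ => (hasSum_norm_sq φ).prod_fiberwise fun x => hasSum_fintype _
  have h := key (coinOp C ψ)
  simp only [coinOp_apply, sum_norm_sq_mulVec (C _) fun j => ψ (_, j)] at h
  exact (sq_eq_sq₀ (norm_nonneg _) (norm_nonneg _)).1 (h.unique (key ψ))

/-- The coin operator as a unitary. -/
noncomputable def coinEquiv (C : Site → Matrix.unitaryGroup (Fin 3) ℂ) :
    L2 (Site × Fin 3) ≃ₗᵢ[ℂ] L2 (Site × Fin 3) where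
  toLinearMap := coinOp C
  invFun := coinOp fun x => (C x)⁻¹
  left_inv := coinOp_coinOp fun x => inv_mul_cancel (C x)
  right_inv := coinOp_coinOp fun x => mul_inv_cancel (C x)
  norm_map' := norm_coinOp C

/-- The scattering walk as a unitary. -/
noncomputable def walkEquiv (C : Site → Matrix.unitaryGroup (Fin 3) ℂ) :
    L2 DirEdge ≃ₗᵢ[ℂ] L2 DirEdge :=
  edgeToCoin.trans ((coinEquiv C).trans (shiftOp.trans edgeToCoin.symm))

theorem star_walk_mul_walk (C : Site → Matrix.unitaryGroup (Fin 3) ℂ) :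
    star (scatteringWalk C) * scatteringWalk C = 1 :=
  (ContinuousLinearMap.norm_map_iff_adjoint_comp_self _).1 (walkEquiv C).norm_map

/-- In infinite dimension an isometry need not be unitary; surjectivity comes from `walkEquiv`. -/
theorem walk_mul_star_walk (C : Site → Matrix.unitaryGroup (Fin 3) ℂ) :
    scatteringWalk C * star (scatteringWalk C) = 1 := by
  ext1 ψ
  obtain ⟨φ, rfl⟩ := (walkEquiv C).surjective ψ
  have h := congrArg (fun f : L2 DirEdge →L[ℂ] L2 DirEdge => scatteringWalk C (f φ))
    (star_walk_mul_walk C)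
  exact h

theorem exists_outEdge (d : DirEdge) : ∃ x i, outEdge x i = d := by
  obtain ⟨i, hi⟩ := exists_label d
  exact ⟨_, _, hi.symm⟩

/-- The edge from `x` to `S_i x` is the coin state `e_i` at `S_i x`, which the shift pulls back to
`e_i` at `x`, where the coin acts. -/
theorem scatteringWalk_outEdge (C : Site → Matrix.unitaryGroup (Fin 3) ℂ) (ψ : L2 DirEdge)
    (x : Site) (i : Fin 3) : scatteringWalk C ψ (outEdge x i) =
      ∑ j, (C x : Matrix (Fin 3) (Fin 3) ℂ) i j * ψ (inEdge (x, j)) := by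
  have h : outEdge x i = inEdge (shift i x, i) := by
    apply SimpleGraph.Dart.ext
    simp [outEdge, inEdge]
  have h1 : scatteringWalk C ψ (outEdge x i) =
      coinOp C (edgeToCoin ψ) ((shift i).symm (shift i x), i) := by
    have h2 : ∀ d, scatteringWalk C ψ d = coinOp C (edgeToCoin ψ)
        ((fun q : Site × Fin 3 => ((shift q.2).symm q.1, q.2))
          ((Equiv.ofBijective inEdge inEdge_bijective).symm d)) := fun _ => rfl
    rw [h, h2, Equiv.ofBijective_symm_apply_apply]
  rw [h1, Equiv.symm_apply_apply, coinOp_apply]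
  rfl

/-- The walk moves the edges that enter `x` to those that leave `x`. -/
theorem scatteringWalk_mul_proj (C : Site → Matrix.unitaryGroup (Fin 3) ℂ) (S : Set Site) :
    scatteringWalk C * proj {d | d.snd ∈ S} = proj {d | d.fst ∈ S} * scatteringWalk C := by
  classical
  ext ψ d
  obtain ⟨x, i, rfl⟩ := exists_outEdge d
  change scatteringWalk C (proj _ ψ) _ = proj _ (scatteringWalk C ψ) _
  rw [proj_apply, scatteringWalk_outEdge, scatteringWalk_outEdge]
  simp only [proj_apply]
  change ∑ j, _ * (if x ∈ S then _ else _) = if x ∈ S then _ else _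
  split_ifs <;> simp

theorem flux_eq (C : Site → Matrix.unitaryGroup (Fin 3) ℂ) (M : Set DirEdge) :
    flux C M = star (scatteringWalk C) * proj M * scatteringWalk C - proj M := rfl

theorem star_walk_mul_proj (C : Site → Matrix.unitaryGroup (Fin 3) ℂ) (S : Set Site) :
    proj {d | d.snd ∈ S} * star (scatteringWalk C) =
      star (scatteringWalk C) * proj {d | d.fst ∈ S} := by
  have := congrArg star (scatteringWalk_mul_proj C S)
  rwa [star_mul, star_mul, (isStarProjection_proj _).isSelfAdjoint.star_eq,
    (isStarProjection_proj _).isSelfAdjoint.star_eq] at this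

/-- Moving the projection past the walk turns edges that enter `S` into edges that leave `S`. -/
theorem conj_proj_mul_proj (C : Site → Matrix.unitaryGroup (Fin 3) ℂ) (M : Set DirEdge)
    (S : Set Site) :
    star (scatteringWalk C) * proj M * scatteringWalk C * proj {d | d.snd ∈ S} =
      star (scatteringWalk C) * proj (M ∩ {d | d.fst ∈ S}) * scatteringWalk C := by
  rw [mul_assoc _ (scatteringWalk C), scatteringWalk_mul_proj, ← proj_mul]
  noncomm_ring

theorem commute_flux_proj (C : Site → Matrix.unitaryGroup (Fin 3) ℂ) (M : Set DirEdge)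
    (S : Set Site) : Commute (flux C M) (proj {d | d.snd ∈ S}) := by
  rw [flux_eq]
  refine Commute.sub_left ?_ ?_
  · have h : proj {d | d.snd ∈ S} * (star (scatteringWalk C) * proj M * scatteringWalk C) =
        proj {d | d.snd ∈ S} * star (scatteringWalk C) * proj M * scatteringWalk C := by
      simp only [mul_assoc]
    rw [Commute, SemiconjBy, conj_proj_mul_proj, h, star_walk_mul_proj, Set.inter_comm, ← proj_mul,
      ← mul_assoc]
  · rw [Commute, SemiconjBy, proj_mul, proj_mul, Set.inter_comm]

theorem isStarProjection_conj_proj (C : Site → Matrix.unitaryGroup (Fin 3) ℂ) (M : Set DirEdge) :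
    IsStarProjection (star (scatteringWalk C) * proj M * scatteringWalk C) where
  isIdempotentElem := by
    calc star (scatteringWalk C) * proj M * scatteringWalk C *
          (star (scatteringWalk C) * proj M * scatteringWalk C) =
        star (scatteringWalk C) * proj M * (scatteringWalk C * star (scatteringWalk C)) *
          proj M * scatteringWalk C := by noncomm_ring
      _ = star (scatteringWalk C) * (proj M * proj M) * scatteringWalk C := by
        rw [walk_mul_star_walk]; noncomm_ring
      _ = _ := by rw [proj_mul, Set.inter_self]
  isSelfAdjoint := by
    rw [IsSelfAdjoint, star_mul, star_mul, star_star,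
      (isStarProjection_proj M).isSelfAdjoint.star_eq, mul_assoc]

theorem range_conj_proj (C : Site → Matrix.unitaryGroup (Fin 3) ℂ) (M : Set DirEdge) :
    LinearMap.range ((star (scatteringWalk C) * proj M * scatteringWalk C :
        L2 DirEdge →L[ℂ] L2 DirEdge) : L2 DirEdge →ₗ[ℂ] L2 DirEdge) =
      (LinearMap.range (proj M : L2 DirEdge →ₗ[ℂ] L2 DirEdge)).map
        ((walkEquiv C).symm.toLinearEquiv : L2 DirEdge →ₗ[ℂ] L2 DirEdge) := by
  have hs : ∀ ψ, star (scatteringWalk C) ψ = (walkEquiv C).symm ψ := fun ψ => by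
    obtain ⟨φ, rfl⟩ := (walkEquiv C).surjective ψ
    rw [LinearIsometryEquiv.symm_apply_apply]
    exact congrArg (fun f : L2 DirEdge →L[ℂ] L2 DirEdge => f φ) (star_walk_mul_walk C)
  ext ψ
  constructor
  · rintro ⟨φ, rfl⟩
    exact ⟨_, ⟨scatteringWalk C φ, rfl⟩, (hs _).symm⟩
  · rintro ⟨_, ⟨φ, rfl⟩, rfl⟩
    obtain ⟨φ, rfl⟩ := (walkEquiv C).surjective φ
    exact ⟨φ, hs _⟩

/-! ## The index of the flux operator -/

theorem sum_outMinusIn (M : Set DirEdge) (S : Finset Site) :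
    ∑ x ∈ S, outMinusIn M x = ((M ∩ {d | d.fst ∈ (S : Set Site)}).ncard : ℤ) -
      (M ∩ {d | d.snd ∈ (S : Set Site)}).ncard := by
  classical
  -- Used for both parametrizations of the directed edges, by initial and by terminal site.
  have key : ∀ (g : Site × Fin 3 → DirEdge), Function.Injective g → ∀ T : Set DirEdge,
      (∀ d, d ∈ T ↔ ∃ x ∈ S, ∃ i, g (x, i) = d) →
      ((M ∩ T).ncard : ℤ) = ∑ x ∈ S, ∑ i, if g (x, i) ∈ M then 1 else 0 := by
    intro g hg T hT
    have : M ∩ T = g '' ((S ×ˢ Finset.univ).filter fun p => g p ∈ M : Finset (Site × Fin 3)) := by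
      ext d
      simp only [Set.mem_inter_iff, hT, Set.mem_image, Finset.coe_filter, Finset.mem_product,
        Finset.mem_univ, and_true, Set.mem_ofPred_eq, Prod.exists]
      constructor
      · rintro ⟨h, x, hx, i, rfl⟩
        exact ⟨x, i, ⟨hx, h⟩, rfl⟩
      · rintro ⟨x, i, ⟨hx, h⟩, rfl⟩
        exact ⟨h, x, hx, i, rfl⟩
    rw [this, Set.ncard_image_of_injective _ hg, Set.ncard_coe_finset, Finset.card_filter,
      Finset.sum_product]
    push_cast
    rfl
  rw [key (fun p => outEdge p.1 p.2) outEdge_injective _, key (fun p => (outEdge p.1 p.2).symm) _ _]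
  · simp only [outMinusIn, Finset.sum_sub_distrib]
  · intro d
    constructor
    · intro hd
      obtain ⟨x, i, h⟩ := exists_outEdge d.symm
      refine ⟨x, ?_, i, ?_⟩
      · have : x = d.snd := congrArg (fun d : DirEdge => d.fst) h
        rwa [this]
      · simp [h]
    · rintro ⟨x, hx, i, rfl⟩
      exact hx
  · exact (SimpleGraph.Dart.symm_involutive).injective.comp outEdge_injective
  · intro d
    constructor
    · intro hd
      obtain ⟨x, i, rfl⟩ := exists_outEdge d
      exact ⟨x, hd, i, rfl⟩
    · rintro ⟨x, hx, i, rfl⟩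
      exact hx

theorem finite_dirEdge_snd (S : Finset Site) : {d : DirEdge | d.snd ∈ (S : Set Site)}.Finite := by
  refine ((S ×ˢ Finset.univ).finite_toSet.image fun p : Site × Fin 3 => (outEdge p.1 p.2).symm).subset
    fun d hd => ?_
  obtain ⟨x, i, h⟩ := exists_outEdge d.symm
  obtain rfl : x = d.snd := congrArg (fun d : DirEdge => d.fst) h
  exact ⟨(d.snd, i), by simpa using hd, by simp [h]⟩

theorem finite_dirEdge_fst (S : Finset Site) : {d : DirEdge | d.fst ∈ (S : Set Site)}.Finite := by
  have := (finite_dirEdge_snd S).image SimpleGraph.Dart.symm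
  refine this.subset fun d hd => ⟨d.symm, hd, d.symm_symm⟩

theorem fluxIndex_flux_mul_proj (C : Site → Matrix.unitaryGroup (Fin 3) ℂ) (M : Set DirEdge)
    (S : Finset Site) :
    fluxIndex (flux C M * proj {d | d.snd ∈ (S : Set Site)}) = ∑ x ∈ S, outMinusIn M x := by
  have hout : (M ∩ {d | d.fst ∈ (S : Set Site)}).Finite := (finite_dirEdge_fst S).inter_of_right _
  have hin : (M ∩ {d | d.snd ∈ (S : Set Site)}).Finite := (finite_dirEdge_snd S).inter_of_right _
  rw [flux_eq, sub_mul, conj_proj_mul_proj, proj_mul]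
  have h1 := finiteDimensional_range_proj _ hin
  have h2 := finiteDimensional_range_proj _ hout
  have h3 : FiniteDimensional ℂ (LinearMap.range ((star (scatteringWalk C) *
      proj (M ∩ {d | d.fst ∈ (S : Set Site)}) * scatteringWalk C :
        L2 DirEdge →L[ℂ] L2 DirEdge) : L2 DirEdge →ₗ[ℂ] L2 DirEdge)) := by
    rw [range_conj_proj]
    infer_instance
  rw [fluxIndex_sub (isStarProjection_conj_proj C _) (isStarProjection_proj _), range_conj_proj,
    LinearEquiv.finrank_map_eq, finrank_range_proj _ hin, finrank_range_proj _ hout, sum_outMinusIn]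

/-- By unitarity, `Φ = 𝓤* (P 𝓤 P^⊥ - P^⊥ 𝓤 P)`. -/
theorem flux_mul_inProj_eq_zero (C : Site → Matrix.unitaryGroup (Fin 3) ℂ) (M : Set DirEdge)
    {x : Site} (hx : x ∉ boundarySites C M) : flux C M * inProj x = 0 := by
  simp only [boundarySites, Set.mem_ofPred_eq, not_or, not_not] at hx
  obtain ⟨h1, h2⟩ := hx
  set W := scatteringWalk C
  have h1' : (1 - proj M) * (W * (proj M * inProj x)) = 0 := h1
  have h2' : proj M * (W * ((1 - proj M) * inProj x)) = 0 := h2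
  calc flux C M * inProj x = star W * proj M * W * inProj x - (star W * W) * proj M * inProj x := by
        rw [flux_eq, star_walk_mul_walk, one_mul, sub_mul]
    _ = star W * (proj M * (W * ((1 - proj M) * inProj x)) -
          (1 - proj M) * (W * (proj M * inProj x))) := by noncomm_ring
    _ = 0 := by rw [h1', h2', sub_zero, mul_zero]

/-- If the flux through the sites outside of the finite set `S` has norm less than one, then the
index is determined by the sites in `S`. -/
theorem indexDefined_flux (C : Site → Matrix.unitaryGroup (Fin 3) ℂ) (M : Set DirEdge)
    (S : Finset Site) {c : ℝ} (hc0 : 0 ≤ c) (hc1 : c < 1)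
    (hc : ∀ x ∉ S, ‖flux C M * inProj x‖ ≤ c) (hne : ∑ x ∈ S, outMinusIn M x ≠ 0) :
    IndexDefined (flux C M) ∧ fluxIndex (flux C M) = ∑ x ∈ S, outMinusIn M x := by
  set e : L2 DirEdge →L[ℂ] L2 DirEdge := proj {d | d.snd ∈ (S : Set Site)} with he_def
  have hcomm : Commute (flux C M) e := commute_flux_proj C M S
  have he : IsIdempotentElem e := (isStarProjection_proj _).isIdempotentElem
  have hsingle : ∀ x, Commute (flux C M) (proj {d | d.snd = x}) := fun x =>
    commute_flux_proj C M {x}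
  have hecomm : ∀ x, Commute e (proj {d : DirEdge | d.snd = x}) := fun x => by
    rw [Commute, SemiconjBy, he_def, proj_mul, proj_mul, Set.inter_comm]
  -- The factor `1 - e` kills the blocks at the sites of `S` and does not change the others.
  have hnorm : ‖flux C M * (1 - e)‖ < 1 := by
    refine lt_of_le_of_lt (norm_le_of_commute_proj (fun d : DirEdge => d.snd) _ (fun x =>
      (hsingle x).mul_left ((Commute.one_left _).sub_left (hecomm x))) hc0 fun x => ?_) hc1
    rw [mul_assoc, sub_mul, one_mul, he_def, proj_mul]
    by_cases hx : x ∈ S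
    · have : {d : DirEdge | d.snd ∈ (S : Set Site)} ∩ {d | d.snd = x} = {d | d.snd = x} :=
        Set.inter_eq_right.2 fun d (hd : d.snd = x) => by
          rw [Set.mem_ofPred_eq, hd]; exact hx
      rw [this, sub_self, mul_zero, norm_zero]
      exact hc0
    · have : {d : DirEdge | d.snd ∈ (S : Set Site)} ∩ {d | d.snd = x} = ∅ := by
        ext d
        simp only [Set.mem_inter_iff, Set.mem_ofPred_eq, Set.mem_empty_iff_false, iff_false, not_and]
        rintro hd rfl
        exact hx hd
      have h0 : proj (∅ : Set DirEdge) = 0 := by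
        classical
        ext ψ d
        rw [proj_apply]
        simp
      rw [this, h0, sub_zero]
      exact hc x hx
  have hind : fluxIndex (flux C M) = ∑ x ∈ S, outMinusIn M x := by
    rw [← fluxIndex_mul_eq hcomm he hnorm, he_def, fluxIndex_flux_mul_proj]
  have := finiteDimensional_range_proj _ (finite_dirEdge_snd S)
  exact ⟨indexDefined_of_commute hcomm he hnorm (by rwa [hind]), hind⟩

theorem finite_siteNorm_le (R : ℝ) : {x | siteNorm x ≤ R}.Finite := by
  -- Connectedness is needed because `dist` is zero by default between sites that are not joined.
  have hreach : ∀ x, hexLattice.Reachable (.A 0 0) x :=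
    site_induction (p := fun x => hexLattice.Reachable (.A 0 0) x) (x₀ := .A 0 0)
      (SimpleGraph.Reachable.refl _) fun x i h => h.trans (SimpleGraph.Adj.reachable ⟨i, rfl⟩)
  have hball : ∀ n : ℕ, {x | ∃ p : hexLattice.Walk x (.A 0 0), p.length = n}.Finite := by
    intro n
    induction n with
    | zero =>
      refine (Set.finite_singleton (Site.A 0 0)).subset ?_
      rintro x ⟨p, hp⟩
      exact SimpleGraph.Walk.eq_of_length_eq_zero hp
    | succ n ih =>
      refine ((Set.finite_univ (α := Fin 3)).image2 (fun i y => shift i y) ih).subset ?_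
      rintro x ⟨p, hp⟩
      cases p with
      | nil => simp at hp
      | @cons _ y _ h p =>
        obtain ⟨i, hi⟩ := h.symm
        exact ⟨i, trivial, y, ⟨p, by simpa using hp⟩, hi⟩
  refine ((Set.finite_Iic ⌊R⌋₊).biUnion fun n _ => hball n).subset fun x hx => ?_
  obtain ⟨p, hp⟩ := (hreach x).exists_walk_length_eq_dist
  refine Set.mem_biUnion (x := hexLattice.dist (.A 0 0) x) (Nat.le_floor hx) ⟨p.reverse, ?_⟩
  rw [SimpleGraph.Walk.length_reverse, hp]

end HexWalk

/-! ### The index of a relevant path -/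

open HexWalk
theorem mainTheorem5 (C : Site → Matrix.unitaryGroup (Fin 3) ℂ) (γ : ℤ → Face)
    (hγ : IsRelevant γ)
    (hsup : ∃ R : ℝ, 0 < R ∧
      sSup ((fun x => ‖flux C (leftSide γ) ∘L inProj x‖) ''
        {x | x ∈ boundarySites C (leftSide γ) ∧ R < siteNorm x}) < 1) :
    IndexDefined (flux C (leftSide γ)) ∧
      (fluxIndex (flux C (leftSide γ)) = 1 ∨ fluxIndex (flux C (leftSide γ)) = -1) := by
  classical
  obtain ⟨R, -, hsup⟩ := hsup
  obtain ⟨S₀, hS₀⟩ := hγ.exists_sum_outMinusIn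
  have hsum := hS₀ (S₀ ∪ (finite_siteNorm_le R).toFinset) Finset.subset_union_left
  -- The real `sSup` of an unbounded set is zero by default, so the hypothesis bounds the blocks
  -- only once this is known.
  have hbdd : BddAbove ((fun x => ‖flux C (leftSide γ) ∘L inProj x‖) ''
      {x | x ∈ boundarySites C (leftSide γ) ∧ R < siteNorm x}) := by
    refine ⟨‖flux C (leftSide γ)‖ * 1, ?_⟩
    rintro _ ⟨x, -, rfl⟩
    exact (ContinuousLinearMap.opNorm_comp_le _ _).trans
      (mul_le_mul_of_nonneg_left (norm_proj_le _) (norm_nonneg _))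
  -- The finite set contains `S₀` for the count and the ball of radius `R` for the bound; the bound
  -- is the maximum of `0` and the supremum.
  obtain ⟨h, hind⟩ := indexDefined_flux C (leftSide γ)
    (S₀ ∪ (finite_siteNorm_le R).toFinset) (le_max_left 0 _)
    (max_lt one_pos hsup) (fun x hx => by
      rw [Finset.mem_union, not_or, Set.Finite.mem_toFinset] at hx
      have hR : R < siteNorm x := not_le.1 hx.2
      by_cases hb : x ∈ boundarySites C (leftSide γ)
      · exact (le_csSup hbdd ⟨x, ⟨hb, hR⟩, rfl⟩).trans (le_max_right _ _)
      · rw [flux_mul_inProj_eq_zero C _ hb, norm_zero]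
        exact le_max_left _ _) (by rw [hsum]; norm_num)
  exact ⟨h, .inr (hind.trans hsum)⟩
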